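/- Notation. Let $n\ge 1$. A convex body in $\mathbb R^n$ is a compact convex set with non-empty interior; it is origin-symmetric if it is invariant under $x\mapsto -x$. For a function $\rho:\mathbb S^{n-1}\to[0,\infty]$, the star-shaped set with radial function $\rho$ is $\{0\}\cup\{t\theta:\theta\in\mathbb S^{n-1},\ 0<t<\infty,\ t\le\rho(\theta)\}$. Write $\mathrm{Vol}$ for $n$-dimensional Lebesgue measure. Let $K\subset\mathbb R^n$ be a convex body. For $p>0$, the Fourier $p$th mean body $F_pK$ is the star-shaped set with radial function $$\rho_{F_pK}(\theta)=\left(\frac{p}{\mathrm{Vol}(K)}\int_0^\infty|\widehat{\chi_K}(r\theta)|^2r^{p-1}\,dr\right)^{1/p},\qquad \widehat{\chi_K}(y)=\int_K e^{-i\langle x,y\rangle}\,dx,$$ and the radial $p$th mean body $R_pK$ is the star-shaped set with radial function $$\rho_{R_pK}(\theta)=\left(p\int_0^\infty\frac{\mathrm{Vol}(K\cap(K+r\theta))}{\mathrm{Vol}(K)}\,r^{p-1}\,dr\right)^{1/p}.$$ For $q>-1$, $q\ne0$, the polar $L^q$ centroid body $\Gamma_q^\circ M$ of a star body $M$ is the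 star-shaped set with radial function $$\rho_{\Gamma_q^\circ M}(u)=\left(\frac1{\mathrm{Vol}(M)}\int_M|\langle x,u\rangle|^q\,dx\right)^{-1/q},$$ and the polar $q$th mean zonoid of $K$ is $$Z_q^\circ K=\left(\frac{\mathrm{Vol}(K)}{\mathrm{Vol}(R_{n+q}K)}\right)^{1/q}\Gamma_q^\circ(R_{n+q}K).$$ Statement. Let $K\subset\mathbb R^n$ be a convex body and let $p\in(0,1)$. Then $$F_pK=\left(\Gamma(1+p)\cos\left(\frac{\pi p}{2}\right)\mathrm{Vol}(K)\right)^{1/p}Z^\circ_{-p}K.$$ In particular, $F_pK$ is an origin-symmetric convex body. -/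

import Mathlib

open MeasureTheory Set
open scoped ENNReal Pointwise RealInnerProductSpace

/-- Euclidean space `ℝⁿ`. -/
abbrev Euc (n : ℕ) : Type := EuclideanSpace ℝ (Fin n)

/-- A convex body: a compact, convex set with non-empty interior. -/
structure IsConvexBody {n : ℕ} (K : Set (Euc n)) : Prop where
  convex : Convex ℝ K
  isCompact : IsCompact K
  nonempty_interior : (interior K).Nonempty

/-- The star-shaped set with radial function `ρ`. Only the values of `ρ` at unit vectors matter; the
value `∞` is allowed (the set then contains the whole ray). The origin always belongs to the set, and
so does the end point `ρ θ • θ` of each segment of finite length. -/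
def starSet {n : ℕ} (ρ : Euc n → ℝ≥0∞) : Set (Euc n) :=
  {x | ENNReal.ofReal ‖x‖ ≤ ρ (‖x‖⁻¹ • x)}

/-- The Fourier transform `f̂(y) = ∫ exp(-i⟨x, y⟩) f(x) dx`. -/
noncomputable def fourierHat {n : ℕ} (f : Euc n → ℂ) (y : Euc n) : ℂ :=
  ∫ x, Complex.exp (-(Complex.I * (⟪x, y⟫ : ℂ))) * f x

/-- The characteristic function `χ_K`. -/
noncomputable def charFn {n : ℕ} (K : Set (Euc n)) : Euc n → ℂ :=
  K.indicator (fun _ => 1)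

/-- The radial function of the Fourier `p`-th mean body,
`θ ↦ (p / Vol(K) * ∫₀^∞ |χ̂_K(rθ)|² r^(p-1) dr)^(1/p)`, as an extended nonnegative number. -/
noncomputable def fourierMeanRadial {n : ℕ} (p : ℝ) (K : Set (Euc n)) (θ : Euc n) : ℝ≥0∞ :=
  (ENNReal.ofReal p / volume K *
    ∫⁻ r in Ioi (0 : ℝ), ENNReal.ofReal (‖fourierHat (charFn K) (r • θ)‖ ^ 2 * r ^ (p - 1))) ^ (1 / p)

/-- The Fourier `p`-th mean body `F_p K`, for `p > 0`. -/
noncomputable def fourierMeanBody {n : ℕ} (p : ℝ) (K : Set (Euc n)) : Set (Euc n) :=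
  starSet (fourierMeanRadial p K)

/-- The covariogram `g_K(x) = Vol(K ∩ (K + x))`. -/
noncomputable def covariogram {n : ℕ} (K : Set (Euc n)) (x : Euc n) : ℝ≥0∞ :=
  volume (K ∩ (x +ᵥ K))

/-- The radial function of the radial `p`-th mean body for `p > 0`,
`θ ↦ (p * ∫₀^∞ (g_K(rθ) / Vol(K)) r^(p-1) dr)^(1/p)`. -/
noncomputable def radialMeanRadial {n : ℕ} (p : ℝ) (K : Set (Euc n)) (θ : Euc n) : ℝ≥0∞ :=
  (ENNReal.ofReal p *
    ∫⁻ r in Ioi (0 : ℝ), covariogram K (r • θ) / volume K * ENNReal.ofReal (r ^ (p - 1))) ^ (1 / p)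

/-- The radial `p`-th mean body `R_p K`, for `p > 0`. -/
noncomputable def radialMeanBody {n : ℕ} (p : ℝ) (K : Set (Euc n)) : Set (Euc n) :=
  starSet (radialMeanRadial p K)

/-- The radial function of the polar `L^q` centroid body, for `q > -1`, `q ≠ 0`,
`u ↦ (1 / Vol(M) * ∫_M |⟨x, u⟩|^q dx)^(-1/q)`. For `q < 0` the integrand is `∞` on the (null)
hyperplane orthogonal to `u`. -/
noncomputable def polarCentroidRadial {n : ℕ} (q : ℝ) (M : Set (Euc n)) (u : Euc n) : ℝ≥0∞ :=
  ((volume M)⁻¹ * ∫⁻ x in M, ENNReal.ofReal |⟪x, u⟫| ^ q) ^ (-1 / q)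

/-- The polar `L^q` centroid body `Γ°_q M`, for `q > -1`, `q ≠ 0`. -/
noncomputable def polarCentroidBody {n : ℕ} (q : ℝ) (M : Set (Euc n)) : Set (Euc n) :=
  starSet (polarCentroidRadial q M)

/-- The polar `q`-th mean zonoid
`Z°_q K = (Vol(K) / Vol(R_{n+q} K))^(1/q) Γ°_q (R_{n+q} K)`, for `q > -1`, `q ≠ 0`, `n ≥ 1`
(so that `n + q > 0`). -/
noncomputable def polarMeanZonoid {n : ℕ} (q : ℝ) (K : Set (Euc n)) : Set (Euc n) :=
  (volume.real K / volume.real (radialMeanBody (n + q) K)) ^ (1 / q) •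
    polarCentroidBody q (radialMeanBody (n + q) K)

open Filter Topology

/-! ### The Prékopa–Leindler inequality -/

/-! Both claims pass through the negative moment N(u) = ∫ |⟨u,x⟩|^(-p) g(x) dx of the covariogram g
= g_K (`negMoment`).

The identity. The covariogram is the autocorrelation of χ_K, so |χ̂_K|² is its cosine transform. For
0 < p < 1 the conditionally convergent integral ∫₀^∞ cos(rt) r^(p-1) dr equals Γ(p) cos(πp/2)
|t|^(-p); regularised by exp(-εr), it turns the radial integral defining F_pK into Γ(p) cos(πp/2)
N(θ) (`lintegral_charFun_mul_rpow`, `lintegral_sq_norm_fourierHat`). On the other side, the radial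
function of R_{n-p}K raised to the power n-p is, up to constants, the radial integral of g against
r^(n-p-1), so polar coordinates give ∫_{R_{n-p}K} |⟨x,u⟩|^(-p) dx = N(u)/Vol(K)
(`setLIntegral_radialMeanBody`). What remains is bookkeeping of constants.

Convexity. It suffices that N^(-1/p) is a norm; homogeneity is clear and the triangle inequality
(`IsLogConcaveBump.negMoment_add_le`) is the substance. It holds for every even log-concave bump g,
and g_K is one by Prékopa–Leindler. Let Q_u(t) be the g-mass of the slab |⟨u,z⟩| ≤ t divided by t,
and τ_u(r) = sup {t : Q_u(t) > r}. Two layer-cake formulas give N(u) = p/(1-p) ∫₀^∞ τ_u(r)^(1-p) dr.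
A Busemann-type inequality 1/Q_{u+v}(s+t) ≤ 1/Q_u(s) + 1/Q_v(t) (`slab_inequality`) says that
τ_u(r₁) + τ_v(r₂) ≤ τ_{u+v}(r₃) whenever 1/r₃ = 1/r₁ + 1/r₂, and an inequality of Ball's type for
such harmonic combinations (`lintegral_rpow_le_of_concave`) integrates this to the triangle
inequality. The slab inequality is itself a consequence of Ball's inequality in the plane
(`lintegral_inv_le_of_logConcave`). Both Ball-type inequalities come from one monotone transport
argument (`le_lintegral_of_harmonic`). -/

theorem lintegral_eq_lintegral_meas_ofReal_lt {α : Type*} [MeasurableSpace α] (μ : Measure α)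
    [SFinite μ] {f : α → ℝ≥0∞} (hf : Measurable f) :
    ∫⁻ x, f x ∂μ = ∫⁻ t in Ioi (0 : ℝ), μ {x | ENNReal.ofReal t < f x} := by
  have key : ∀ c : ℝ≥0∞,
      ∫⁻ t in Ioi (0 : ℝ), {t : ℝ | ENNReal.ofReal t < c}.indicator (fun _ => (1 : ℝ≥0∞)) t = c := by
    intro c
    have hm : MeasurableSet {t : ℝ | ENNReal.ofReal t < c} :=
      measurableSet_lt ENNReal.measurable_ofReal measurable_const
    rw [lintegral_indicator hm, lintegral_const, one_mul, Measure.restrict_apply_univ,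
      Measure.restrict_apply hm]
    by_cases hc : c = ∞
    · subst hc
      simp
    · have : {t : ℝ | ENNReal.ofReal t < c} ∩ Ioi 0 = Ioo 0 c.toReal := by
        ext t
        simp only [mem_inter_iff, mem_ofPred_eq, mem_Ioi, mem_Ioo]
        constructor
        · rintro ⟨h1, h2⟩
          exact ⟨h2, (ENNReal.ofReal_lt_iff_lt_toReal h2.le hc).1 h1⟩
        · rintro ⟨h1, h2⟩
          exact ⟨(ENNReal.ofReal_lt_iff_lt_toReal h1.le hc).2 h2, h1⟩
      rw [this, Real.volume_Ioo, sub_zero, ENNReal.ofReal_toReal hc]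
  have hS : MeasurableSet {q : α × ℝ | ENNReal.ofReal q.2 < f q.1} :=
    measurableSet_lt (ENNReal.measurable_ofReal.comp measurable_snd) (hf.comp measurable_fst)
  calc ∫⁻ x, f x ∂μ
      = ∫⁻ x, (∫⁻ t in Ioi (0 : ℝ),
          {q : α × ℝ | ENNReal.ofReal q.2 < f q.1}.indicator (fun _ => (1 : ℝ≥0∞)) (x, t)) ∂μ :=
        lintegral_congr fun x => (key (f x)).symm
    _ = ∫⁻ t in Ioi (0 : ℝ), ∫⁻ x,
          {q : α × ℝ | ENNReal.ofReal q.2 < f q.1}.indicator (fun _ => (1 : ℝ≥0∞)) (x, t) ∂μ :=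
        lintegral_lintegral_swap (measurable_const.indicator hS).aemeasurable
    _ = _ := by
        refine lintegral_congr fun t => ?_
        have hm : MeasurableSet {x | ENNReal.ofReal t < f x} :=
          measurableSet_lt measurable_const hf
        rw [← lintegral_indicator_one hm]
        rfl

/-- One-dimensional Brunn–Minkowski: A + B contains the translates min B + A and max A + B, which
meet at most in the point max A + min B. -/
theorem Real.volume_add_le_of_isCompact {A B : Set ℝ} (hA : IsCompact A) (hB : IsCompact B)
    (hA' : A.Nonempty) (hB' : B.Nonempty) : volume A + volume B ≤ volume (A + B) := by
  have ha := hA.sSup_mem hA'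
  have hb := hB.sInf_mem hB'
  set a := sSup A
  set b := sInf B
  have h1 : volume (b +ᵥ A) = volume A := measure_vadd _ _ _
  have h2 : volume (a +ᵥ B) = volume B := measure_vadd _ _ _
  have hsub : (b +ᵥ A) ∪ (a +ᵥ B) ⊆ A + B := by
    rintro x (⟨y, hy, rfl⟩ | ⟨y, hy, rfl⟩)
    · exact ⟨y, hy, b, hb, by simp [add_comm]⟩
    · exact ⟨a, ha, y, hy, rfl⟩
  have hint : (b +ᵥ A) ∩ (a +ᵥ B) ⊆ {a + b} := by
    rintro x ⟨⟨y, hy, rfl⟩, ⟨z, hz, hzy⟩⟩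
    have hy' : y ≤ a := le_csSup hA.bddAbove hy
    have hz' : b ≤ z := csInf_le hB.bddBelow hz
    simp only [vadd_eq_add] at hzy ⊢
    simp only [mem_singleton_iff]
    linarith
  have h0 : volume ((b +ᵥ A) ∩ (a +ᵥ B)) = 0 :=
    measure_mono_null hint (measure_singleton _)
  have hBm : MeasurableSet (a +ᵥ B) := (hB.vadd a).measurableSet
  calc volume A + volume B = volume ((b +ᵥ A) ∪ (a +ᵥ B)) := by
        rw [← h1, ← h2, ← measure_union_add_inter _ hBm, h0, add_zero]
    _ ≤ _ := measure_mono hsub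

/-- Inner regularity reduces this to compact sets, where the sum is compact and the previous lemma
applies. -/
theorem Real.mul_volume_add_mul_volume_le {A B C : Set ℝ} (hA : MeasurableSet A)
    (hB : MeasurableSet B) (hA' : A.Nonempty) (hB' : B.Nonempty) {a b : ℝ} (ha : 0 < a)
    (hb : 0 < b) (h : ∀ x ∈ A, ∀ y ∈ B, a * x + b * y ∈ C) :
    ENNReal.ofReal a * volume A + ENNReal.ofReal b * volume B ≤ volume C := by
  have key : ∀ K ⊆ A, IsCompact K → ∀ L ⊆ B, IsCompact L → K.Nonempty → L.Nonempty →
      ENNReal.ofReal a * volume K + ENNReal.ofReal b * volume L ≤ volume C := by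
    intro K hK hKc L hL hLc hK' hL'
    have e1 : ENNReal.ofReal a * volume K = volume (a • K) := by
      rw [Measure.addHaar_smul]; simp [abs_of_pos ha]
    have e2 : ENNReal.ofReal b * volume L = volume (b • L) := by
      rw [Measure.addHaar_smul]; simp [abs_of_pos hb]
    rw [e1, e2]
    refine (Real.volume_add_le_of_isCompact (hKc.smul a) (hLc.smul b) hK'.smul_set
      hL'.smul_set).trans (measure_mono ?_)
    rintro _ ⟨_, ⟨x, hx, rfl⟩, _, ⟨y, hy, rfl⟩, rfl⟩
    exact h x (hK hx) y (hL hy)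
  obtain ⟨x0, hx0⟩ := hA'
  obtain ⟨y0, hy0⟩ := hB'
  -- The compact sets in the supremum may be empty; adjoining a fixed point of A or of B makes them
  -- non-empty.
  have key2 : ∀ K ⊆ A, IsCompact K → ∀ L ⊆ B, IsCompact L →
      ENNReal.ofReal a * volume K + ENNReal.ofReal b * volume L ≤ volume C := by
    intro K hK hKc L hL hLc
    refine le_trans ?_ (key (insert x0 K) (insert_subset hx0 hK) (hKc.insert x0)
      (insert y0 L) (insert_subset hy0 hL) (hLc.insert y0) (insert_nonempty _ _)
      (insert_nonempty _ _))
    gcongr <;> exact subset_insert _ _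
  rw [hA.measure_eq_iSup_isCompact, hB.measure_eq_iSup_isCompact]
  simp only [ENNReal.mul_iSup]
  simp only [iSup_and', iSup_subtype']
  have : Nonempty {K : Set ℝ // K ⊆ A ∧ IsCompact K} := ⟨⟨∅, empty_subset _, isCompact_empty⟩⟩
  have : Nonempty {K : Set ℝ // K ⊆ B ∧ IsCompact K} := ⟨⟨∅, empty_subset _, isCompact_empty⟩⟩
  exact ENNReal.iSup_add_iSup_le fun K L => key2 K.1 K.2.1 K.2.2 L.1 L.2.1 L.2.2

theorem ENNReal.rpow_mul_rpow_le_add {a b : ℝ} (ha : 0 < a) (hb : 0 < b) (hab : a + b = 1)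
    (x y : ℝ≥0∞) : x ^ a * y ^ b ≤ ENNReal.ofReal a * x + ENNReal.ofReal b * y := by
  by_cases hx : x = ∞
  · simp [hx, ENNReal.mul_top, ha]
  by_cases hy : y = ∞
  · simp [hy, ENNReal.mul_top, hb]
  lift x to NNReal using hx
  lift y to NNReal using hy
  have := NNReal.geom_mean_le_arith_mean2_weighted a.toNNReal b.toNNReal x y
    (by rw [← Real.toNNReal_add ha.le hb.le, hab, Real.toNNReal_one])
  rw [Real.coe_toNNReal _ ha.le, Real.coe_toNNReal _ hb.le] at this
  rw [← ENNReal.coe_rpow_of_nonneg _ ha.le, ← ENNReal.coe_rpow_of_nonneg _ hb.le]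
  rw [← ENNReal.coe_mul]
  exact (ENNReal.coe_le_coe.2 this).trans (by simp [ENNReal.ofReal])

/-- A measure on a real vector space satisfies the Prékopa–Leindler inequality. -/
def PrekopaLeindler {V : Type*} [AddCommGroup V] [Module ℝ V] [MeasurableSpace V]
    (μ : Measure V) : Prop :=
  ∀ (a b : ℝ), 0 < a → 0 < b → a + b = 1 → ∀ f g h : V → ℝ≥0∞, Measurable f → Measurable g →
    Measurable h → (∀ x y, f x ^ a * g y ^ b ≤ h (a • x + b • y)) →
    (∫⁻ x, f x ∂μ) ^ a * (∫⁻ x, g x ∂μ) ^ b ≤ ∫⁻ x, h x ∂μ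

/-- If f x > t and g y > t, then h(ax + by) > t, so Brunn–Minkowski applies to superlevel sets at
each height t < 1, where those of f and g are non-empty. Integration over t gives the additive form
of Prékopa–Leindler. -/
theorem lintegral_le_of_superlevel {f g h : ℝ → ℝ≥0∞} (hf : Measurable f)
    (hg : Measurable g) (hh : Measurable h) {a b : ℝ} (ha : 0 < a) (hb : 0 < b) (hab : a + b = 1)
    (hf1 : ∀ x, f x ≤ 1) (hg1 : ∀ x, g x ≤ 1)
    (hf2 : ∀ t : ℝ, 0 < t → t < 1 → ∃ x, ENNReal.ofReal t < f x)
    (hg2 : ∀ t : ℝ, 0 < t → t < 1 → ∃ x, ENNReal.ofReal t < g x)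
    (H : ∀ x y, f x ^ a * g y ^ b ≤ h (a • x + b • y)) :
    ENNReal.ofReal a * (∫⁻ x, f x) + ENNReal.ofReal b * (∫⁻ x, g x) ≤ ∫⁻ x, h x := by
  have cut : ∀ f : ℝ → ℝ≥0∞, Measurable f → (∀ x, f x ≤ 1) →
      ∫⁻ x, f x = ∫⁻ t in Ioo (0 : ℝ) 1, volume {x | ENNReal.ofReal t < f x} := by
    intro f hf hf1
    rw [lintegral_eq_lintegral_meas_ofReal_lt _ hf, ← Ioo_union_Ici_eq_Ioi (zero_lt_one' ℝ),
      lintegral_union measurableSet_Ici]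
    · have : ∫⁻ t in Ici (1 : ℝ), volume {x | ENNReal.ofReal t < f x} = 0 := by
        rw [setLIntegral_congr_fun (g := fun _ => 0) measurableSet_Ici]
        · simp
        · intro t ht
          have : {x | ENNReal.ofReal t < f x} = ∅ := by
            ext x
            simp only [mem_ofPred_eq, mem_empty_iff_false, iff_false, not_lt]
            exact (hf1 x).trans (by rw [← ENNReal.ofReal_one]; exact ENNReal.ofReal_le_ofReal ht)
          simp [this]
      rw [this, add_zero]
    · rw [Set.disjoint_left]
      intro x hx hx'
      exact absurd hx.2 (not_lt.2 hx')
  have meas : ∀ f : ℝ → ℝ≥0∞, Measurable fun t : ℝ => volume {x | ENNReal.ofReal t < f x} := by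
    intro f
    refine Antitone.measurable fun s t hst => measure_mono fun x hx => ?_
    exact lt_of_le_of_lt (ENNReal.ofReal_le_ofReal hst) hx
  rw [cut f hf hf1, cut g hg hg1, lintegral_eq_lintegral_meas_ofReal_lt _ hh,
    ← lintegral_const_mul _ (meas f), ← lintegral_const_mul _ (meas g),
    ← lintegral_add_left ((meas f).const_mul _)]
  refine le_trans ?_ (lintegral_mono_set (Ioo_subset_Ioi_self : Ioo (0 : ℝ) 1 ⊆ _))
  refine setLIntegral_mono' measurableSet_Ioo fun t ht => ?_
  refine Real.mul_volume_add_mul_volume_le (measurableSet_lt measurable_const hf)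
    (measurableSet_lt measurable_const hg) (hf2 t ht.1 ht.2) (hg2 t ht.1 ht.2) ha hb ?_
  intro x hx y hy
  refine lt_of_lt_of_le ?_ (H x y)
  calc ENNReal.ofReal t = ENNReal.ofReal t ^ a * ENNReal.ofReal t ^ b := by
        rw [← ENNReal.rpow_add_of_nonneg _ _ ha.le hb.le, hab, ENNReal.rpow_one]
    _ < f x ^ a * g y ^ b :=
        ENNReal.mul_lt_mul (ENNReal.rpow_lt_rpow hx ha) (ENNReal.rpow_lt_rpow hy hb)

/-- The statement is invariant under scaling f and g, provided h is scaled by the matching geometric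
mean. Normalising both suprema to 1 gives the additive form, which is stronger than the product form
by weighted AM–GM. -/
theorem prekopaLeindler_real_of_bounded {f g h : ℝ → ℝ≥0∞} (hf : Measurable f)
    (hg : Measurable g) (hh : Measurable h) {a b : ℝ} (ha : 0 < a) (hb : 0 < b) (hab : a + b = 1)
    (hf1 : ⨆ x, f x ≠ ∞) (hg1 : ⨆ x, g x ≠ ∞)
    (H : ∀ x y, f x ^ a * g y ^ b ≤ h (a • x + b • y)) :
    (∫⁻ x, f x) ^ a * (∫⁻ x, g x) ^ b ≤ ∫⁻ x, h x := by
  by_cases hf0 : ⨆ x, f x = 0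
  · have : ∀ x, f x = 0 := by simpa using hf0
    simp [this, ha]
  by_cases hg0 : ⨆ x, g x = 0
  · have : ∀ x, g x = 0 := by simpa using hg0
    simp [this, hb]
  have ex : ∀ f : ℝ → ℝ≥0∞, ⨆ x, f x ≠ ∞ → ⨆ x, f x ≠ 0 → ∀ t : ℝ, 0 < t → t < 1 →
      ∃ x, ENNReal.ofReal t < (⨆ x, f x)⁻¹ * f x := by
    intro f hf1 hf0 t ht ht1
    have : ENNReal.ofReal t * ⨆ x, f x < ⨆ x, f x := by
      conv_rhs => rw [← one_mul (⨆ x, f x)]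
      exact ENNReal.mul_lt_mul_left hf0 hf1 (by simpa using ht1)
    obtain ⟨x, hx⟩ := lt_iSup_iff.1 this
    refine ⟨x, ?_⟩
    rw [mul_comm, ← div_eq_mul_inv]
    exact (ENNReal.lt_div_iff_mul_lt (Or.inl hf0) (Or.inl hf1)).2 hx
  have le1 : ∀ f : ℝ → ℝ≥0∞, ⨆ x, f x ≠ ∞ → ⨆ x, f x ≠ 0 → ∀ x, (⨆ x, f x)⁻¹ * f x ≤ 1 := by
    intro f hf1 hf0 x
    rw [← ENNReal.inv_mul_cancel hf0 hf1]
    gcongr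
    exact le_iSup f x
  set M := ⨆ x, f x
  set M' := ⨆ x, g x
  set c := M⁻¹ ^ a * M'⁻¹ ^ b with hc
  have hc0 : c ≠ 0 := by simp [hc, hf1, hg1, ha.not_gt, hb.not_gt]
  have hci : c ≠ ∞ := by
    refine ENNReal.mul_ne_top (ENNReal.rpow_ne_top_of_nonneg ha.le ?_)
      (ENNReal.rpow_ne_top_of_nonneg hb.le ?_) <;> simpa
  have key := lintegral_le_of_superlevel (hf.const_mul M⁻¹) (hg.const_mul M'⁻¹) (hh.const_mul c)
    ha hb hab (le1 f hf1 hf0) (le1 g hg1 hg0) (ex f hf1 hf0) (ex g hg1 hg0) (by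
      intro x y
      rw [ENNReal.mul_rpow_of_nonneg _ _ ha.le, ENNReal.mul_rpow_of_nonneg _ _ hb.le,
        mul_mul_mul_comm]
      gcongr
      exact H x y)
  replace key := (ENNReal.rpow_mul_rpow_le_add ha hb hab _ _).trans key
  rw [lintegral_const_mul _ hf, lintegral_const_mul _ hg, lintegral_const_mul _ hh,
    ENNReal.mul_rpow_of_nonneg _ _ ha.le, ENNReal.mul_rpow_of_nonneg _ _ hb.le,
    mul_mul_mul_comm] at key
  exact (ENNReal.mul_le_mul_iff_right hc0 hci).1 key

theorem prekopaLeindler_real : PrekopaLeindler (volume : Measure ℝ) := by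
  intro a b ha hb hab f g h hf hg hh H
  have tend : ∀ f : ℝ → ℝ≥0∞, Measurable f → ∀ a : ℝ,
      Tendsto (fun N : ℕ => (∫⁻ x, min (f x) N) ^ a) atTop (𝓝 ((∫⁻ x, f x) ^ a)) := by
    intro f hf a
    refine (ENNReal.continuous_rpow_const.tendsto _).comp ?_
    refine lintegral_tendsto_of_tendsto_of_monotone
      (fun N => (hf.min measurable_const).aemeasurable) ?_ ?_
    · refine Eventually.of_forall fun x N M hNM => ?_
      exact min_le_min le_rfl (by exact_mod_cast hNM)
    · refine Eventually.of_forall fun x => ?_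
      simpa using (tendsto_const_nhds (x := f x)).min ENNReal.tendsto_nat_nhds_top
  -- Truncation at height N and monotone convergence remove boundedness. Vanishing factors are set
  -- aside first because multiplication is discontinuous at (0, ∞).
  by_cases h0 : (∫⁻ x, f x) ^ a = 0
  · simp [h0]
  by_cases h1 : (∫⁻ x, g x) ^ b = 0
  · simp [h1]
  refine le_of_tendsto' (ENNReal.Tendsto.mul (tend f hf a) (Or.inl h0) (tend g hg b) (Or.inl h1))
    fun N => ?_
  have bd : ∀ f : ℝ → ℝ≥0∞, ⨆ x, min (f x) (N : ℝ≥0∞) ≠ ∞ := fun f =>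
    ne_top_of_le_ne_top (ENNReal.natCast_ne_top N) (iSup_le fun x => min_le_right _ _)
  refine prekopaLeindler_real_of_bounded (hf.min measurable_const) (hg.min measurable_const) hh
    ha hb hab (bd f) (bd g) fun x y => le_trans ?_ (H x y)
  gcongr <;> exact min_le_left _ _

/-- By the inequality on W, the fibre integrals of f, g, h again satisfy the hypothesis, now on V;
Tonelli concludes. -/
theorem PrekopaLeindler.prod {V W : Type*} [AddCommGroup V] [Module ℝ V] [MeasurableSpace V]
    [AddCommGroup W] [Module ℝ W] [MeasurableSpace W] {μ : Measure V} {ν : Measure W} [SFinite ν]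
    (hμ : PrekopaLeindler μ) (hν : PrekopaLeindler ν) : PrekopaLeindler (μ.prod ν) := by
  intro a b ha hb hab f g h hf hg hh H
  rw [lintegral_prod _ hf.aemeasurable, lintegral_prod _ hg.aemeasurable,
    lintegral_prod _ hh.aemeasurable]
  refine hμ a b ha hb hab _ _ _ hf.lintegral_prod_right' hg.lintegral_prod_right'
    hh.lintegral_prod_right' fun x y => ?_
  exact hν a b ha hb hab _ _ _ (hf.comp measurable_prodMk_left) (hg.comp measurable_prodMk_left)
    (hh.comp measurable_prodMk_left) fun z w => H (x, z) (y, w)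

theorem PrekopaLeindler.map {V W : Type*} [AddCommGroup V] [Module ℝ V] [MeasurableSpace V]
    [AddCommGroup W] [Module ℝ W] [MeasurableSpace W] {μ : Measure V}
    (hμ : PrekopaLeindler μ) {e : V → W} (he : Measurable e)
    (hlin : ∀ (a b : ℝ) x y, e (a • x + b • y) = a • e x + b • e y) :
    PrekopaLeindler (μ.map e) := by
  intro a b ha hb hab f g h hf hg hh H
  rw [lintegral_map hf he, lintegral_map hg he, lintegral_map hh he]
  exact hμ a b ha hb hab _ _ _ (hf.comp he) (hg.comp he) (hh.comp he) fun x y => by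
    simpa only [Function.comp, hlin] using H (e x) (e y)

theorem PrekopaLeindler.smul {V : Type*} [AddCommGroup V] [Module ℝ V] [MeasurableSpace V]
    {μ : Measure V} (hμ : PrekopaLeindler μ) (c : ℝ≥0∞) : PrekopaLeindler (c • μ) := by
  intro a b ha hb hab f g h hf hg hh H
  simp only [lintegral_smul_measure, smul_eq_mul]
  rw [ENNReal.mul_rpow_of_nonneg _ _ ha.le, ENNReal.mul_rpow_of_nonneg _ _ hb.le,
    mul_mul_mul_comm, ← ENNReal.rpow_add_of_nonneg _ _ ha.le hb.le, hab, ENNReal.rpow_one]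
  gcongr
  exact hμ a b ha hb hab f g h hf hg hh H

theorem prekopaLeindler_pi (k : ℕ) : PrekopaLeindler (volume : Measure (Fin k → ℝ)) := by
  induction k with
  | zero =>
    intro a b ha hb hab f g h hf hg hh H
    have hv : (volume : Measure (Fin 0 → ℝ)) = Measure.dirac default := by
      rw [Measure.volume_pi_eq_dirac (default : Fin 0 → ℝ)]
    rw [hv, lintegral_dirac, lintegral_dirac, lintegral_dirac]
    exact (H default default).trans_eq (congrArg h (Subsingleton.elim _ _))
  | succ k ih =>
    have mp := (volume_preserving_piFinSuccAbove (fun _ : Fin (k + 1) => ℝ) 0).symm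
    rw [← mp.map_eq]
    refine (prekopaLeindler_real.prod ih).map mp.measurable fun a b x y => ?_
    ext i
    refine Fin.cases ?_ (fun i => ?_) i <;> simp [MeasurableEquiv.piFinSuccAbove]

/-- By uniqueness of Haar measure, μ is a multiple of the image of Lebesgue measure under a linear
isomorphism. -/
theorem prekopaLeindler_addHaar {V : Type*} [NormedAddCommGroup V] [NormedSpace ℝ V]
    [FiniteDimensional ℝ V] [MeasurableSpace V] [BorelSpace V] (μ : Measure V)
    [μ.IsAddHaarMeasure] : PrekopaLeindler μ := by
  have e : (Fin (Module.finrank ℝ V) → ℝ) ≃L[ℝ] V :=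
    ContinuousLinearEquiv.ofFinrankEq (by simp)
  rw [Measure.isAddLeftInvariant_eq_smul μ
    ((volume : Measure (Fin (Module.finrank ℝ V) → ℝ)).map e)]
  exact ((prekopaLeindler_pi _).map e.continuous.measurable (by simp)).smul
    (Measure.addHaarScalarFactor μ _ : ℝ≥0∞)

/-- Log-concavity of `ℝ≥0∞`-valued functions. -/
def LogConcave {V : Type*} [AddCommGroup V] [Module ℝ V] (f : V → ℝ≥0∞) : Prop :=
  ∀ (a b : ℝ), 0 < a → 0 < b → a + b = 1 → ∀ x y, f x ^ a * f y ^ b ≤ f (a • x + b • y)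

/-- Prékopa's theorem: Prékopa–Leindler is applied to the three fibres over x, y and ax + by. -/
theorem LogConcave.lintegral {V W : Type*} [AddCommGroup V] [Module ℝ V] [MeasurableSpace V]
    [AddCommGroup W] [Module ℝ W] [MeasurableSpace W] {ν : Measure W}
    (hν : PrekopaLeindler ν) {f : V × W → ℝ≥0∞} (hf : LogConcave f) (hm : Measurable f) :
    LogConcave fun x => ∫⁻ y, f (x, y) ∂ν := by
  intro a b ha hb hab x y
  exact hν a b ha hb hab _ _ _ (hm.comp measurable_prodMk_left) (hm.comp measurable_prodMk_left)
    (hm.comp measurable_prodMk_left) fun z w => hf a b ha hb hab (x, z) (y, w)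

theorem LogConcave.comp {V W : Type*} [AddCommGroup V] [Module ℝ V]
    [AddCommGroup W] [Module ℝ W] {f : W → ℝ≥0∞} (hf : LogConcave f) {e : V → W}
    (he : ∀ (a b : ℝ) x y, e (a • x + b • y) = a • e x + b • e y) :
    LogConcave fun x => f (e x) := by
  intro a b ha hb hab x y
  simpa only [he] using hf a b ha hb hab (e x) (e y)

theorem LogConcave.mul {V : Type*} [AddCommGroup V] [Module ℝ V] {f g : V → ℝ≥0∞}
    (hf : LogConcave f) (hg : LogConcave g) : LogConcave fun x => f x * g x := by
  intro a b ha hb hab x y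
  dsimp only
  rw [ENNReal.mul_rpow_of_nonneg _ _ ha.le, ENNReal.mul_rpow_of_nonneg _ _ hb.le,
    mul_mul_mul_comm]
  exact mul_le_mul' (hf a b ha hb hab x y) (hg a b ha hb hab x y)

theorem Convex.logConcave_indicator {V : Type*} [AddCommGroup V] [Module ℝ V] {s : Set V}
    (hs : Convex ℝ s) : LogConcave (s.indicator fun _ => 1) := by
  intro a b ha hb hab x y
  by_cases hx : x ∈ s
  · by_cases hy : y ∈ s
    · simp [hx, hy, hs hx hy ha.le hb.le hab]
    · simp [hy, hb]
  · simp [hx, ha]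

/-- An even log-concave function is non-increasing along rays. -/
theorem LogConcave.le_smul {V : Type*} [AddCommGroup V] [Module ℝ V] {f : V → ℝ≥0∞}
    (hf : LogConcave f) (heven : ∀ x, f (-x) = f x) (x : V) {t : ℝ} (ht0 : 0 ≤ t) (ht1 : t ≤ 1) :
    f x ≤ f (t • x) := by
  rcases ht1.eq_or_lt with rfl | ht1
  · simp
  -- The point tx is a convex combination of x and -x, where f takes the same value.
  have := hf ((1 + t) / 2) ((1 - t) / 2) (by linarith) (by linarith) (by ring) x (-x)
  rw [heven, ← ENNReal.rpow_add_of_nonneg _ _ (by linarith) (by linarith)] at this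
  convert! this using 2
  · rw [show (1 + t) / 2 + (1 - t) / 2 = 1 by ring, ENNReal.rpow_one]
  · rw [smul_neg, ← sub_eq_add_neg, ← sub_smul]
    congr 1; ring

/-! ### Ball's inequality for harmonic combinations, by monotone transport -/

/-- The quantile function of a non-increasing density on the half-line. -/
theorem exists_quantile {f : ℝ → ℝ} (hf : AntitoneOn f (Ioi 0)) (hf0 : ∀ r, 0 < r → 0 ≤ f r)
    (hfi : IntegrableOn f (Ioi 0)) {A : ℝ} (hA : ∫ r in Ioi 0, f r = A) (hA0 : 0 < A) :
    ∃ T : ℝ → ℝ, MonotoneOn T (Ioo 0 1) ∧ (∀ θ ∈ Ioo (0 : ℝ) 1, 0 < T θ ∧ 0 < f (T θ)) ∧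
      ∃ N : Set ℝ, N.Countable ∧ ∀ θ ∈ Ioo (0 : ℝ) 1 \ N, HasDerivAt T (A / f (T θ)) θ := by
  set Φ : ℝ → ℝ := fun R => A⁻¹ * ∫ r in (0 : ℝ)..R, f r with hΦ
  have hint : ∀ a b, 0 ≤ a → 0 ≤ b → IntervalIntegrable f volume a b := fun a b ha hb =>
    ⟨hfi.mono_set fun x hx => lt_of_le_of_lt ha hx.1, hfi.mono_set fun x hx => lt_of_le_of_lt hb hx.1⟩
  have hΦ0 : Φ 0 = 0 := by simp [hΦ]
  have hΦd : ∀ a b, 0 ≤ a → 0 ≤ b → Φ b - Φ a = A⁻¹ * ∫ r in a..b, f r := by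
    intro a b ha hb
    simp only [hΦ]
    rw [← mul_sub, intervalIntegral.integral_interval_sub_left (hint _ _ le_rfl hb)
      (hint _ _ le_rfl ha)]
  have hΦm : MonotoneOn Φ (Ici 0) := by
    intro a ha b hb hab
    have := hΦd a b ha hb
    have h2 : 0 ≤ ∫ r in a..b, f r := by
      rw [intervalIntegral.integral_of_le hab]
      exact setIntegral_nonneg measurableSet_Ioc fun x hx => hf0 x (lt_of_le_of_lt ha hx.1)
    have : 0 ≤ A⁻¹ * ∫ r in a..b, f r := by positivity
    linarith
  have hΦc : ContinuousOn Φ (Ici 0) := by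
    have h1 : Continuous fun R => A⁻¹ * ∫ r in (0 : ℝ)..R, (Ioi 0).indicator f r :=
      ((integrable_indicator_iff measurableSet_Ioi).2 hfi).continuous_primitive 0 |>.const_mul _
    refine h1.continuousOn.congr fun R hR => ?_
    simp only [hΦ]
    congr 1
    refine intervalIntegral.integral_congr_ae (Eventually.of_forall fun x hx => ?_)
    rw [uIoc_of_le (mem_Ici.1 hR)] at hx
    rw [indicator_of_mem (mem_Ioi.2 hx.1)]
  have hΦt : Tendsto Φ atTop (𝓝 1) := by
    have := (intervalIntegral_tendsto_integral_Ioi 0 hfi tendsto_id).const_mul A⁻¹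
    rw [hA, inv_mul_cancel₀ hA0.ne'] at this
    exact this
  -- the range of `Φ`
  have hex : ∀ θ ∈ Ioo (0 : ℝ) 1, ∃ r, 0 < r ∧ Φ r = θ := by
    intro θ hθ
    obtain ⟨R, hR, hR0⟩ := ((hΦt.eventually (lt_mem_nhds hθ.2)).and (eventually_ge_atTop 0)).exists
    obtain ⟨r, hr, hrθ⟩ := intermediate_value_Icc hR0 (hΦc.mono Icc_subset_Ici_self)
      (show θ ∈ Icc (Φ 0) (Φ R) from ⟨by rw [hΦ0]; exact hθ.1.le, hR.le⟩)
    refine ⟨r, lt_of_le_of_ne hr.1 ?_, hrθ⟩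
    rintro rfl
    rw [hΦ0] at hrθ
    exact hθ.1.ne hrθ
  -- Otherwise the non-increasing f would vanish beyond r, and Φ would stay at Φ r < 1 instead of
  -- tending to 1. Hence Φ is strictly increasing until it reaches 1, so its inverse T is
  -- continuous.
  have hpos : ∀ r, 0 < r → Φ r < 1 → ∀ ε > 0, ∃ s, r < s ∧ s < r + ε ∧ 0 < f s := by
    intro r hr hr1 ε hε
    by_contra! hcon
    have hz : ∀ s, r < s → f s = 0 := by
      intro s hs
      obtain ⟨s', hs', hs''⟩ := exists_between (lt_min hs (by linarith : r < r + ε))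
      have h1 := hcon s' hs' (hs''.trans_le (min_le_right _ _))
      refine le_antisymm ?_ (hf0 s (hr.trans hs))
      exact (hf (hr.trans hs') (hr.trans hs) (hs''.trans_le (min_le_left _ _)).le).trans h1
    have : ∀ᶠ R in atTop, Φ R = Φ r := by
      filter_upwards [eventually_ge_atTop r] with R hR
      have h1 := hΦd r R hr.le (hr.le.trans hR)
      have h2 : ∫ s in r..R, f s = 0 := by
        rw [intervalIntegral.integral_of_le hR]
        exact setIntegral_eq_zero_of_forall_eq_zero fun s hs => hz s hs.1
      rw [h2, mul_zero] at h1
      linarith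
    have h2 := tendsto_nhds_unique hΦt (tendsto_const_nhds.congr' (this.mono fun R hR => hR.symm))
    linarith
  have hstrict : ∀ r ε, 0 < r → Φ r < 1 → 0 < ε → Φ r < Φ (r + ε) := by
    intro r ε hr hr1 hε
    obtain ⟨s, hs1, hs2, hs3⟩ := hpos r hr hr1 ε hε
    have h1 := hΦd r s hr.le (hr.trans hs1).le
    have h2 : 0 < ∫ x in r..s, f x := by
      refine lt_of_lt_of_le (mul_pos (sub_pos.2 hs1) hs3) ?_
      have := intervalIntegral.integral_mono_on hs1.le (f := fun _ => f s) (g := f)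
        intervalIntegrable_const (hint r s hr.le (hr.trans hs1).le)
        (fun x hx => hf (lt_of_lt_of_le hr hx.1) (hr.trans hs1) hx.2)
      simpa using this
    have h3 : 0 < A⁻¹ * ∫ x in r..s, f x := by positivity
    have h4 := hΦm (hr.trans hs1).le (show (0 : ℝ) ≤ r + ε by linarith) hs2.le
    linarith
  choose! T hT0 hTΦ using hex
  have hlt : ∀ θ ∈ Ioo (0 : ℝ) 1, ∀ R, 0 ≤ R → θ < Φ R → T θ < R := by
    intro θ hθ R hR h
    by_contra! hcon
    have := hΦm hR (hR.trans hcon) hcon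
    rw [hTΦ θ hθ] at this
    linarith
  have hgt : ∀ θ ∈ Ioo (0 : ℝ) 1, ∀ R, 0 ≤ R → Φ R < θ → R < T θ := by
    intro θ hθ R hR h
    by_contra! hcon
    have := hΦm (hT0 θ hθ).le hR hcon
    rw [hTΦ θ hθ] at this
    linarith
  have hTm : StrictMonoOn T (Ioo 0 1) := fun a ha b hb hab =>
    hgt b hb _ (hT0 a ha).le (by rwa [hTΦ a ha])
  have hTf : ∀ θ ∈ Ioo (0 : ℝ) 1, 0 < f (T θ) := by
    intro θ hθ
    obtain ⟨s, hs1, hs2, hs3⟩ := hpos (T θ) (hT0 θ hθ) (by rw [hTΦ θ hθ]; exact hθ.2) 1 one_pos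
    exact hs3.trans_le (hf (hT0 θ hθ) ((hT0 θ hθ).trans hs1) hs1.le)
  have hTc : ∀ θ ∈ Ioo (0 : ℝ) 1, ContinuousAt T θ := by
    intro θ hθ
    have hmem : ∀ᶠ y in 𝓝 θ, y ∈ Ioo (0 : ℝ) 1 := isOpen_Ioo.mem_nhds hθ
    rw [ContinuousAt, tendsto_order]
    constructor
    · intro R hR
      rcases le_or_gt R 0 with hR0 | hR0
      · filter_upwards [hmem] with y hy using hR0.trans_lt (hT0 y hy)
      · have hRθ : Φ R < θ := by
          have h1 : Φ R ≤ θ := (hΦm hR0.le (hT0 θ hθ).le hR.le).trans_eq (hTΦ θ hθ)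
          have := hstrict R (T θ - R) hR0 (h1.trans_lt hθ.2) (sub_pos.2 hR)
          rwa [add_sub_cancel, hTΦ θ hθ] at this
        filter_upwards [hmem, lt_mem_nhds hRθ] with y hy hy' using hgt y hy R hR0.le hy'
    · intro R hR
      have hR0 : 0 < R := (hT0 θ hθ).trans hR
      have hRθ : θ < Φ R := by
        have := hstrict (T θ) (R - T θ) (hT0 θ hθ) (by rw [hTΦ θ hθ]; exact hθ.2) (sub_pos.2 hR)
        rwa [add_sub_cancel, hTΦ θ hθ] at this
      filter_upwards [hmem, gt_mem_nhds hRθ] with y hy hy' using hlt y hy R hR0.le hy'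
  -- A monotone function has countably many discontinuities, and T is injective, so N is countable.
  -- Off N, Φ has derivative f/A at T θ and the inverse function rule applies.
  set N : Set ℝ := {θ ∈ Ioo (0 : ℝ) 1 | ¬ ContinuousWithinAt f (Ioi 0) (T θ)} with hN
  refine ⟨T, hTm.monotoneOn, fun θ hθ => ⟨hT0 θ hθ, hTf θ hθ⟩, N, ?_, ?_⟩
  · have h1 := hf.countable_not_continuousWithinAt
    refine Set.MapsTo.countable_of_injOn (f := T) ?_ (hTm.injOn.mono fun θ hθ => hθ.1) h1
    exact fun θ hθ => ⟨hT0 θ hθ.1, hθ.2⟩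
  · rintro θ ⟨hθ, hθN⟩
    have hc : ContinuousAt f (T θ) := by
      have : ContinuousWithinAt f (Ioi 0) (T θ) := by
        by_contra h
        exact hθN ⟨hθ, h⟩
      exact this.continuousAt (Ioi_mem_nhds (hT0 θ hθ))
    have hmeas : StronglyMeasurableAtFilter f (𝓝 (T θ)) volume :=
      ⟨Ioi 0, Ioi_mem_nhds (hT0 θ hθ), hfi.1⟩
    have hd : HasDerivAt Φ (A⁻¹ * f (T θ)) (T θ) :=
      (intervalIntegral.integral_hasDerivAt_right (hint 0 (T θ) le_rfl (hT0 θ hθ).le) hmeas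
        hc).const_mul _
    have := hd.of_local_left_inverse (hTc θ hθ) (mul_pos (inv_pos.2 hA0) (hTf θ hθ)).ne'
      (by
        filter_upwards [isOpen_Ioo.mem_nhds hθ] with y hy using hTΦ y hy)
    convert! this using 1
    rw [mul_inv, inv_inv, div_eq_mul_inv]

/-- Monotone transport along harmonic combinations `r₃⁻¹ = r₁⁻¹ + r₂⁻¹`. -/
theorem le_lintegral_of_harmonic {f₁ f₂ : ℝ → ℝ} (hf₁ : AntitoneOn f₁ (Ioi 0))
    (hf₂ : AntitoneOn f₂ (Ioi 0)) (h₁ : ∀ r, 0 < r → 0 ≤ f₁ r) (h₂ : ∀ r, 0 < r → 0 ≤ f₂ r)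
    (hi₁ : IntegrableOn f₁ (Ioi 0)) (hi₂ : IntegrableOn f₂ (Ioi 0)) {A₁ A₂ : ℝ}
    (hA₁ : ∫ r in Ioi 0, f₁ r = A₁) (hA₂ : ∫ r in Ioi 0, f₂ r = A₂) (hp₁ : 0 < A₁) (hp₂ : 0 < A₂)
    {f₃ : ℝ → ℝ≥0∞} {C : ℝ≥0∞}
    (H : ∀ r₁ r₂, 0 < r₁ → 0 < r₂ → 0 < f₁ r₁ → 0 < f₂ r₂ →
      C ≤ ENNReal.ofReal ((r₂ / (r₁ + r₂)) ^ 2 * (A₁ / f₁ r₁) +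
        (r₁ / (r₁ + r₂)) ^ 2 * (A₂ / f₂ r₂)) * f₃ (r₁ * r₂ / (r₁ + r₂))) :
    C ≤ ∫⁻ r in Ioi 0, f₃ r := by
  obtain ⟨T₁, hm₁, hp₁, N₁, hN₁, hd₁⟩ := exists_quantile hf₁ h₁ hi₁ hA₁ hp₁
  obtain ⟨T₂, hm₂, hp₂, N₂, hN₂, hd₂⟩ := exists_quantile hf₂ h₂ hi₂ hA₂ hp₂
  set s : Set ℝ := Ioo (0 : ℝ) 1 \ (N₁ ∪ N₂) with hs
  have hsm : MeasurableSet s := measurableSet_Ioo.diff (hN₁.union hN₂).measurableSet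
  set T : ℝ → ℝ := fun θ => T₁ θ * T₂ θ / (T₁ θ + T₂ θ) with hT
  have hmono : MonotoneOn T s := by
    intro a ha b hb hab
    have a1 := (hp₁ a ha.1).1
    have a2 := (hp₂ a ha.1).1
    have b1 := (hp₁ b hb.1).1
    have b2 := (hp₂ b hb.1).1
    have m1 := hm₁ ha.1 hb.1 hab
    have m2 := hm₂ ha.1 hb.1 hab
    simp only [hT]
    rw [div_le_div_iff₀ (by positivity) (by positivity)]
    nlinarith [mul_le_mul_of_nonneg_left m2 (mul_pos a1 b1).le,
      mul_le_mul_of_nonneg_left m1 (mul_pos a2 b2).le]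
  have hder : ∀ θ ∈ s, HasDerivWithinAt T ((T₂ θ / (T₁ θ + T₂ θ)) ^ 2 * (A₁ / f₁ (T₁ θ)) +
      (T₁ θ / (T₁ θ + T₂ θ)) ^ 2 * (A₂ / f₂ (T₂ θ))) s θ := by
    intro θ hθ
    have a1 := (hp₁ θ hθ.1).1
    have a2 := (hp₂ θ hθ.1).1
    have d1 := hd₁ θ ⟨hθ.1, fun h => hθ.2 (Or.inl h)⟩
    have d2 := hd₂ θ ⟨hθ.1, fun h => hθ.2 (Or.inr h)⟩
    have := ((d1.mul d2).div (d1.add d2) (add_pos a1 a2).ne').hasDerivWithinAt (s := s)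
    convert! this using 1
    simp only [Pi.mul_apply, Pi.add_apply]
    generalize A₁ / f₁ (T₁ θ) = x
    generalize A₂ / f₂ (T₂ θ) = y
    field_simp
    ring
  -- The set s has measure one. The first factor in H is the derivative of T, so the substitution r
  -- = T θ turns the pointwise bound into a bound for the integral of f₃.
  calc C = ∫⁻ _ in s, C := by
        rw [setLIntegral_const]
        have : volume s = 1 := by
          rw [hs, measure_sdiff_null ((hN₁.union hN₂).measure_zero _)]
          simp
        rw [this, mul_one]
    _ ≤ ∫⁻ θ in s, ENNReal.ofReal ((T₂ θ / (T₁ θ + T₂ θ)) ^ 2 * (A₁ / f₁ (T₁ θ)) +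
          (T₁ θ / (T₁ θ + T₂ θ)) ^ 2 * (A₂ / f₂ (T₂ θ))) * f₃ (T θ) :=
        setLIntegral_mono' hsm fun θ hθ => H _ _ (hp₁ θ hθ.1).1 (hp₂ θ hθ.1).1 (hp₁ θ hθ.1).2
          (hp₂ θ hθ.1).2
    _ = ∫⁻ r in T '' s, f₃ r :=
        (lintegral_image_eq_lintegral_deriv_mul_of_monotoneOn hsm hder hmono f₃).symm
    _ ≤ _ := by
        refine lintegral_mono_set ?_
        rintro _ ⟨θ, hθ, rfl⟩
        have a1 := (hp₁ θ hθ.1).1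
        have a2 := (hp₂ θ hθ.1).1
        exact div_pos (mul_pos a1 a2) (add_pos a1 a2)

theorem AntitoneOn.lt_top_of_lintegral {f : ℝ → ℝ≥0∞} (hf : AntitoneOn f (Ioi 0))
    (hi : ∫⁻ r in Ioi 0, f r ≠ ∞) {r : ℝ} (hr : 0 < r) : f r < ∞ := by
  by_contra h
  rw [not_lt, top_le_iff] at h
  refine hi (top_le_iff.1 ?_)
  calc ∞ = ∫⁻ _ in Ioc 0 r, ∞ := by simp [hr]
    _ ≤ ∫⁻ x in Ioc 0 r, f x := setLIntegral_mono' measurableSet_Ioc fun x hx => by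
        rw [← h]; exact hf hx.1 hr hx.2
    _ ≤ _ := lintegral_mono_set Ioc_subset_Ioi_self

theorem AntitoneOn.integrableOn_toReal {f : ℝ → ℝ≥0∞} (hf : AntitoneOn f (Ioi 0))
    (hi : ∫⁻ r in Ioi 0, f r ≠ ∞) :
    IntegrableOn (fun r => (f r).toReal) (Ioi 0) ∧
      ∫ r in Ioi 0, (f r).toReal = (∫⁻ r in Ioi 0, f r).toReal := by
  have hm : AEMeasurable f (volume.restrict (Ioi 0)) :=
    aemeasurable_restrict_of_antitoneOn measurableSet_Ioi hf
  refine ⟨integrable_toReal_of_lintegral_ne_top hm hi, integral_toReal hm ?_⟩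
  filter_upwards [ae_restrict_mem measurableSet_Ioi] with r hr using hf.lt_top_of_lintegral hi hr

/-- The transport inequality for `ℝ≥0∞`-valued functions. -/
theorem le_lintegral_of_harmonic_ennreal {f₁ f₂ f₃ : ℝ → ℝ≥0∞} (hf₁ : AntitoneOn f₁ (Ioi 0))
    (hf₂ : AntitoneOn f₂ (Ioi 0)) (hi₁ : ∫⁻ r in Ioi 0, f₁ r ≠ ∞) (hi₂ : ∫⁻ r in Ioi 0, f₂ r ≠ ∞)
    (h₁ : ∫⁻ r in Ioi 0, f₁ r ≠ 0) (h₂ : ∫⁻ r in Ioi 0, f₂ r ≠ 0) {C : ℝ≥0∞}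
    (H : ∀ r₁ r₂ a b, 0 < r₁ → 0 < r₂ → 0 < a → 0 < b → f₁ r₁ = ENNReal.ofReal a →
      f₂ r₂ = ENNReal.ofReal b →
      C ≤ ENNReal.ofReal ((r₂ / (r₁ + r₂)) ^ 2 * ((∫⁻ r in Ioi 0, f₁ r).toReal / a) +
        (r₁ / (r₁ + r₂)) ^ 2 * ((∫⁻ r in Ioi 0, f₂ r).toReal / b)) * f₃ (r₁ * r₂ / (r₁ + r₂))) :
    C ≤ ∫⁻ r in Ioi 0, f₃ r := by
  have anti : ∀ f : ℝ → ℝ≥0∞, AntitoneOn f (Ioi 0) → ∫⁻ r in Ioi 0, f r ≠ ∞ →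
      AntitoneOn (fun r => (f r).toReal) (Ioi 0) := fun f hf hi a ha b hb hab =>
    ENNReal.toReal_mono (hf.lt_top_of_lintegral hi ha).ne (hf ha hb hab)
  refine le_lintegral_of_harmonic (anti f₁ hf₁ hi₁) (anti f₂ hf₂ hi₂)
    (fun r _ => ENNReal.toReal_nonneg) (fun r _ => ENNReal.toReal_nonneg)
    (hf₁.integrableOn_toReal hi₁).1 (hf₂.integrableOn_toReal hi₂).1
    (hf₁.integrableOn_toReal hi₁).2 (hf₂.integrableOn_toReal hi₂).2
    (ENNReal.toReal_pos h₁ hi₁) (ENNReal.toReal_pos h₂ hi₂) fun r₁ r₂ hr₁ hr₂ ha hb => ?_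
  exact H r₁ r₂ _ _ hr₁ hr₂ ha hb (ENNReal.ofReal_toReal (hf₁.lt_top_of_lintegral hi₁ hr₁).ne).symm
    (ENNReal.ofReal_toReal (hf₂.lt_top_of_lintegral hi₂ hr₂).ne).symm

/-- Weighted AM–GM twice, with (xA)^x (yB)^y in between: once for xA/a and yB/b, once for the
reciprocals of xA and yB, whose weighted mean is 1/A + 1/B. -/
theorem harmonic_le_of_logConcave {x y a b A B : ℝ} (hx : 0 < x) (hy : 0 < y) (hxy : x + y = 1)
    (ha : 0 < a) (hb : 0 < b) (hA : 0 < A) (hB : 0 < B) :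
    (A⁻¹ + B⁻¹)⁻¹ ≤ (x ^ 2 * (A / a) + y ^ 2 * (B / b)) * (a ^ x * b ^ y) := by
  have h1 := Real.geom_mean_le_arith_mean2_weighted hx.le hy.le
    (by positivity : 0 ≤ x * A / a) (by positivity : 0 ≤ y * B / b) hxy
  have h2 := Real.geom_mean_le_arith_mean2_weighted hx.le hy.le
    (by positivity : 0 ≤ (x * A)⁻¹) (by positivity : 0 ≤ (y * B)⁻¹) hxy
  have e1 : x * (x * A)⁻¹ + y * (y * B)⁻¹ = A⁻¹ + B⁻¹ := by field_simp
  have e2 : x * (x * A / a) + y * (y * B / b) = x ^ 2 * (A / a) + y ^ 2 * (B / b) := by ring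
  rw [e1, Real.inv_rpow (by positivity), Real.inv_rpow (by positivity), ← mul_inv] at h2
  rw [e2, Real.div_rpow (by positivity) ha.le, Real.div_rpow (by positivity) hb.le] at h1
  calc (A⁻¹ + B⁻¹)⁻¹ ≤ (x * A) ^ x * (y * B) ^ y :=
        (inv_anti₀ (by positivity) h2).trans_eq (inv_inv _)
    _ = ((x * A) ^ x / a ^ x * ((y * B) ^ y / b ^ y)) * (a ^ x * b ^ y) := by
        field_simp
    _ ≤ _ := by gcongr

/-- Ball's inequality in dimension one: the harmonic Prékopa–Leindler inequality. -/
theorem lintegral_inv_le_of_logConcave {f₁ f₂ f₃ : ℝ → ℝ≥0∞} (hf₁ : AntitoneOn f₁ (Ioi 0))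
    (hf₂ : AntitoneOn f₂ (Ioi 0)) (hi₁ : ∫⁻ r in Ioi 0, f₁ r ≠ ∞) (hi₂ : ∫⁻ r in Ioi 0, f₂ r ≠ ∞)
    (h₁ : ∫⁻ r in Ioi 0, f₁ r ≠ 0) (h₂ : ∫⁻ r in Ioi 0, f₂ r ≠ 0)
    (H : ∀ r₁ r₂, 0 < r₁ → 0 < r₂ →
      f₁ r₁ ^ (r₂ / (r₁ + r₂)) * f₂ r₂ ^ (r₁ / (r₁ + r₂)) ≤ f₃ (r₁ * r₂ / (r₁ + r₂))) :
    (∫⁻ r in Ioi 0, f₃ r)⁻¹ ≤ (∫⁻ r in Ioi 0, f₁ r)⁻¹ + (∫⁻ r in Ioi 0, f₂ r)⁻¹ := by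
  set A := ∫⁻ r in Ioi 0, f₁ r with hA
  set B := ∫⁻ r in Ioi 0, f₂ r with hB
  have hA0 := ENNReal.toReal_pos h₁ hi₁
  have hB0 := ENNReal.toReal_pos h₂ hi₂
  have key : ENNReal.ofReal ((A.toReal⁻¹ + B.toReal⁻¹)⁻¹) ≤ ∫⁻ r in Ioi 0, f₃ r := by
    refine le_lintegral_of_harmonic_ennreal hf₁ hf₂ hi₁ hi₂ h₁ h₂ ?_
    intro r₁ r₂ a b hr₁ hr₂ ha hb ea eb
    have hx : 0 < r₂ / (r₁ + r₂) := by positivity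
    have hy : 0 < r₁ / (r₁ + r₂) := by positivity
    have hxy : r₂ / (r₁ + r₂) + r₁ / (r₁ + r₂) = 1 := by field_simp; ring
    refine (ENNReal.ofReal_le_ofReal
      (harmonic_le_of_logConcave hx hy hxy ha hb hA0 hB0)).trans ?_
    rw [ENNReal.ofReal_mul (by positivity)]
    gcongr
    refine le_trans (le_of_eq ?_) (H r₁ r₂ hr₁ hr₂)
    rw [ea, eb, ENNReal.ofReal_rpow_of_pos ha, ENNReal.ofReal_rpow_of_pos hb,
      ENNReal.ofReal_mul (by positivity)]
  refine (ENNReal.inv_le_inv.2 key).trans (le_of_eq ?_)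
  rw [← ENNReal.ofReal_inv_of_pos (by positivity), inv_inv,
    ENNReal.ofReal_add (by positivity) (by positivity), ENNReal.ofReal_inv_of_pos hA0,
    ENNReal.ofReal_inv_of_pos hB0, ENNReal.ofReal_toReal hi₁, ENNReal.ofReal_toReal hi₂]

/-- Hölder's inequality for sums of two terms: after division by the right side, weighted AM–GM is
applied to each term. -/
theorem Real.rpow_mul_rpow_add_le {a b c d p : ℝ} (ha : 0 < a) (hb : 0 < b) (hc : 0 < c)
    (hd : 0 < d) (hp0 : 0 < p) (hp1 : p < 1) :
    a ^ (1 - p) * c ^ p + b ^ (1 - p) * d ^ p ≤ (a + b) ^ (1 - p) * (c + d) ^ p := by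
  have h1 := Real.geom_mean_le_arith_mean2_weighted (sub_pos.2 hp1).le hp0.le
    (by positivity : 0 ≤ a / (a + b)) (by positivity : 0 ≤ c / (c + d)) (by ring)
  have h2 := Real.geom_mean_le_arith_mean2_weighted (sub_pos.2 hp1).le hp0.le
    (by positivity : 0 ≤ b / (a + b)) (by positivity : 0 ≤ d / (c + d)) (by ring)
  rw [Real.div_rpow (by positivity) (by positivity), Real.div_rpow (by positivity) (by positivity)]
    at h1 h2
  have e : (1 - p) * (a / (a + b)) + p * (c / (c + d)) +
      ((1 - p) * (b / (a + b)) + p * (d / (c + d))) = 1 := by field_simp; ring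
  have h3 := (add_le_add h1 h2).trans_eq e
  have hX : 0 < (a + b) ^ (1 - p) := by positivity
  have hY : 0 < (c + d) ^ p := by positivity
  have e2 : a ^ (1 - p) / (a + b) ^ (1 - p) * (c ^ p / (c + d) ^ p) +
      b ^ (1 - p) / (a + b) ^ (1 - p) * (d ^ p / (c + d) ^ p) =
      (a ^ (1 - p) * c ^ p + b ^ (1 - p) * d ^ p) / ((a + b) ^ (1 - p) * (c + d) ^ p) := by
    field_simp
  rw [e2, div_le_one (by positivity)] at h3
  exact h3

/-- Hölder with c = A^(-1/p), d = B^(-1/p) bounds a^(1-p)/A + b^(1-p)/B from above; Cauchy–Schwarz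
bounds its product with the first factor on the right from below by (x + y)² = 1. -/
theorem harmonic_le_of_concave {x y a b A B p : ℝ} (hxy : x + y = 1)
    (ha : 0 < a) (hb : 0 < b) (hA : 0 < A) (hB : 0 < B) (hp0 : 0 < p) (hp1 : p < 1) :
    (A ^ (-1 / p) + B ^ (-1 / p)) ^ (-p) ≤
      (x ^ 2 * (A / a ^ (1 - p)) + y ^ 2 * (B / b ^ (1 - p))) * (a + b) ^ (1 - p) := by
  have hA' : (A ^ (-1 / p)) ^ p = A⁻¹ := by
    rw [← Real.rpow_mul hA.le, div_mul_cancel₀ _ hp0.ne', Real.rpow_neg_one]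
  have hB' : (B ^ (-1 / p)) ^ p = B⁻¹ := by
    rw [← Real.rpow_mul hB.le, div_mul_cancel₀ _ hp0.ne', Real.rpow_neg_one]
  have h := Real.rpow_mul_rpow_add_le ha hb (Real.rpow_pos_of_pos hA (-1 / p))
    (Real.rpow_pos_of_pos hB (-1 / p)) hp0 hp1
  rw [hA', hB'] at h
  have hS : 0 < (A ^ (-1 / p) + B ^ (-1 / p)) ^ p := by positivity
  rw [Real.rpow_neg (by positivity)]
  generalize (A ^ (-1 / p) + B ^ (-1 / p)) ^ p = S at h hS ⊢
  have hu : 0 < a ^ (1 - p) := by positivity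
  have hv : 0 < b ^ (1 - p) := by positivity
  have hG : 0 < (a + b) ^ (1 - p) := by positivity
  generalize a ^ (1 - p) = u at h hu ⊢
  generalize b ^ (1 - p) = v at h hv ⊢
  generalize (a + b) ^ (1 - p) = G at h hG ⊢
  -- Cauchy–Schwarz; with z = Av/(Bu) the cross terms are x²z + y²/z ≥ 2xy.
  have h1 : 1 ≤ (x ^ 2 * (A / u) + y ^ 2 * (B / v)) * (u * A⁻¹ + v * B⁻¹) := by
    have e : (x ^ 2 * (A / u) + y ^ 2 * (B / v)) * (u * A⁻¹ + v * B⁻¹) =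
        x ^ 2 + y ^ 2 + (x ^ 2 * (A * v / (B * u)) + y ^ 2 * (B * u / (A * v))) := by
      field_simp; ring
    have hz : 0 < A * v / (B * u) := by positivity
    have e2 : B * u / (A * v) = (A * v / (B * u))⁻¹ := by rw [inv_div]
    rw [e, e2]
    generalize A * v / (B * u) = z at hz
    have : 2 * x * y ≤ x ^ 2 * z + y ^ 2 * z⁻¹ := by
      have h3 : 0 ≤ (x * z - y) ^ 2 * z⁻¹ := by positivity
      have h4 : (x * z - y) ^ 2 * z⁻¹ = x ^ 2 * z + y ^ 2 * z⁻¹ - 2 * x * y := by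
        field_simp; ring
      linarith
    nlinarith [congrArg (· ^ 2) hxy]
  have h5 : 0 ≤ x ^ 2 * (A / u) + y ^ 2 * (B / v) := by positivity
  rw [inv_le_iff_one_le_mul₀ hS, mul_assoc]
  exact h1.trans (mul_le_mul_of_nonneg_left h h5)

theorem ENNReal.rpow_le_rpow_of_nonpos {x y : ℝ≥0∞} {z : ℝ} (hz : z ≤ 0) (h : x ≤ y) :
    y ^ z ≤ x ^ z := by
  rw [← neg_neg z, ENNReal.rpow_neg, ENNReal.rpow_neg x]
  exact ENNReal.inv_le_inv.2 (ENNReal.rpow_le_rpow h (by linarith))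

/-- A Ball-type inequality for concave radial profiles. -/
theorem lintegral_rpow_le_of_concave {t₁ t₂ t₃ : ℝ → ℝ} {p : ℝ} (hp0 : 0 < p) (hp1 : p < 1)
    (ht₁ : AntitoneOn t₁ (Ioi 0)) (ht₂ : AntitoneOn t₂ (Ioi 0)) (hn₁ : ∀ r, 0 < r → 0 ≤ t₁ r)
    (hn₂ : ∀ r, 0 < r → 0 ≤ t₂ r)
    (hi₁ : ∫⁻ r in Ioi 0, ENNReal.ofReal (t₁ r ^ (1 - p)) ≠ ∞)
    (hi₂ : ∫⁻ r in Ioi 0, ENNReal.ofReal (t₂ r ^ (1 - p)) ≠ ∞)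
    (h₁ : ∫⁻ r in Ioi 0, ENNReal.ofReal (t₁ r ^ (1 - p)) ≠ 0)
    (h₂ : ∫⁻ r in Ioi 0, ENNReal.ofReal (t₂ r ^ (1 - p)) ≠ 0)
    (H : ∀ r₁ r₂, 0 < r₁ → 0 < r₂ → 0 < t₁ r₁ → 0 < t₂ r₂ →
      t₁ r₁ + t₂ r₂ ≤ t₃ (r₁ * r₂ / (r₁ + r₂))) :
    (∫⁻ r in Ioi 0, ENNReal.ofReal (t₃ r ^ (1 - p))) ^ (-1 / p) ≤
      (∫⁻ r in Ioi 0, ENNReal.ofReal (t₁ r ^ (1 - p))) ^ (-1 / p) +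
        (∫⁻ r in Ioi 0, ENNReal.ofReal (t₂ r ^ (1 - p))) ^ (-1 / p) := by
  have anti : ∀ t : ℝ → ℝ, AntitoneOn t (Ioi 0) → (∀ r, 0 < r → 0 ≤ t r) →
      AntitoneOn (fun r => ENNReal.ofReal (t r ^ (1 - p))) (Ioi 0) := fun t ht hn a ha b hb hab =>
    ENNReal.ofReal_le_ofReal (Real.rpow_le_rpow (hn b hb) (ht ha hb hab) (by linarith))
  set A := ∫⁻ r in Ioi 0, ENNReal.ofReal (t₁ r ^ (1 - p)) with hA
  set B := ∫⁻ r in Ioi 0, ENNReal.ofReal (t₂ r ^ (1 - p)) with hB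
  have hA0 := ENNReal.toReal_pos h₁ hi₁
  have hB0 := ENNReal.toReal_pos h₂ hi₂
  have key : ENNReal.ofReal ((A.toReal ^ (-1 / p) + B.toReal ^ (-1 / p)) ^ (-p)) ≤
      ∫⁻ r in Ioi 0, ENNReal.ofReal (t₃ r ^ (1 - p)) := by
    refine le_lintegral_of_harmonic_ennreal (anti t₁ ht₁ hn₁) (anti t₂ ht₂ hn₂) hi₁ hi₂ h₁ h₂ ?_
    intro r₁ r₂ a b hr₁ hr₂ ha hb ea eb
    have pos : ∀ t a : ℝ, 0 ≤ t → 0 < a → ENNReal.ofReal (t ^ (1 - p)) = ENNReal.ofReal a →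
        0 < t ∧ a = t ^ (1 - p) := by
      intro t a ht ha h
      have h' := (ENNReal.ofReal_eq_ofReal_iff (Real.rpow_nonneg ht _) ha.le).1 h
      refine ⟨ht.lt_of_ne ?_, h'.symm⟩
      rintro rfl
      rw [Real.zero_rpow (by linarith)] at h'
      exact ha.ne h'
    obtain ⟨p1, e1⟩ := pos _ _ (hn₁ r₁ hr₁) ha ea
    obtain ⟨p2, e2⟩ := pos _ _ (hn₂ r₂ hr₂) hb eb
    have hxy : r₂ / (r₁ + r₂) + r₁ / (r₁ + r₂) = 1 := by field_simp; ring
    refine (ENNReal.ofReal_le_ofReal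
      (harmonic_le_of_concave hxy p1 p2 hA0 hB0 hp0 hp1)).trans ?_
    rw [e1, e2, ENNReal.ofReal_mul (by positivity)]
    gcongr
    exact H r₁ r₂ hr₁ hr₂ p1 p2
  have hneg : -1 / p ≤ 0 := by
    rw [neg_div]; simp [hp0.le]
  have hS : 0 < A.toReal ^ (-1 / p) + B.toReal ^ (-1 / p) := by positivity
  refine (ENNReal.rpow_le_rpow_of_nonpos hneg key).trans (le_of_eq ?_)
  rw [ENNReal.ofReal_rpow_of_pos (by positivity), ← Real.rpow_mul hS.le,
    show -p * (-1 / p) = 1 by field_simp, Real.rpow_one,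
    ENNReal.ofReal_add (by positivity) (by positivity), ← ENNReal.ofReal_rpow_of_pos hA0,
    ← ENNReal.ofReal_rpow_of_pos hB0, ENNReal.ofReal_toReal hi₁, ENNReal.ofReal_toReal hi₂]

/-! ### Fibre densities of log-concave functions -/

/-- Bounded, even, log-concave functions with bounded support which are positive near the origin. -/
structure IsLogConcaveBump {E : Type*} [NormedAddCommGroup E] [InnerProductSpace ℝ E]
    [MeasurableSpace E] (g : E → ℝ≥0∞) : Prop where
  measurable : Measurable g
  even : ∀ x, g (-x) = g x
  logConcave : LogConcave g
  bounded : ∃ B : ℝ≥0∞, B ≠ ∞ ∧ ∀ x, g x ≤ B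
  support : ∃ R : ℝ, ∀ x, g x ≠ 0 → ‖x‖ ≤ R
  pos : ∃ δ > 0, ∃ c : ℝ≥0∞, c ≠ 0 ∧ ∀ x, ‖x‖ < δ → c ≤ g x

section

variable {E : Type*} [NormedAddCommGroup E] [InnerProductSpace ℝ E] [FiniteDimensional ℝ E]
  [MeasurableSpace E] [BorelSpace E]

theorem lintegral_neg_eq {V : Type*} [AddGroup V] [MeasurableSpace V] [MeasurableNeg V]
    (μ : Measure V) [μ.IsNegInvariant] (f : V → ℝ≥0∞) :
    ∫⁻ x, f (-x) ∂μ = ∫⁻ x, f x ∂μ :=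
  (Measure.measurePreserving_neg μ).lintegral_comp_emb (MeasurableEquiv.neg V).measurableEmbedding f

theorem LogConcave.const_mul {V : Type*} [AddCommGroup V] [Module ℝ V] {f : V → ℝ≥0∞}
    (hf : LogConcave f) (c : ℝ≥0∞) : LogConcave fun x => c * f x := by
  refine LogConcave.mul (f := fun _ => c) ?_ hf
  intro a b ha hb hab x y
  dsimp only
  rw [← ENNReal.rpow_add_of_nonneg _ _ ha.le hb.le, hab, ENNReal.rpow_one]

/-- The image of the measure `g(x) dx` under a surjective linear map has an even log-concave
density. -/
theorem IsLogConcaveBump.exists_density {g : E → ℝ≥0∞} (hg : IsLogConcaveBump g) {F : Type*}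
    [NormedAddCommGroup F] [NormedSpace ℝ F] [FiniteDimensional ℝ F] [MeasurableSpace F]
    [BorelSpace F] (μ : Measure F) [μ.IsAddHaarMeasure] (f : E →ₗ[ℝ] F)
    (hf : Function.Surjective f) :
    ∃ m : F → ℝ≥0∞, Measurable m ∧ LogConcave m ∧ (∀ y, m (-y) = m y) ∧ m 0 ≠ ∞ ∧
      ∀ φ : F → ℝ≥0∞, Measurable φ → ∫⁻ z, φ (f z) * g z = ∫⁻ y, φ y * m y ∂μ := by
  obtain ⟨s, hs⟩ := f.exists_rightInverse_of_surjective (LinearMap.range_eq_top.2 hf)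
  replace hs : ∀ y, f (s y) = y := fun y => LinearMap.congr_fun hs y
  -- A linear section s of f splits E as F × ker f. In these coordinates Lebesgue measure is κ times
  -- a product measure, and the density is κ times the integral of g over the fibre, log-concave by
  -- Prékopa's theorem.
  let L' : (F × LinearMap.ker f) ≃ₗ[ℝ] E :=
    { toFun := fun q => s q.1 + q.2
      map_add' := fun q q' => by simp; abel
      map_smul' := fun c q => by simp
      invFun := fun z => (f z, ⟨z - s (f z), by simp [hs]⟩)
      left_inv := fun q => by
        have : f (q.2 : E) = 0 := q.2.2
        ext <;> simp [hs, this]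
      right_inv := fun z => by simp }
  let L : (F × LinearMap.ker f) ≃L[ℝ] E := L'.toContinuousLinearEquiv
  have hL : ∀ q, L q = s q.1 + q.2 := fun q => rfl
  set ν : Measure (LinearMap.ker f) := volume
  have huniq := Measure.isAddLeftInvariant_eq_smul (volume : Measure E) ((μ.prod ν).map L)
  set κ := Measure.addHaarScalarFactor (volume : Measure E) ((μ.prod ν).map L)
  have hint : ∀ G : E → ℝ≥0∞, Measurable G →
      ∫⁻ z, G z = κ * ∫⁻ y, ∫⁻ w, G (L (y, w)) ∂ν ∂μ := by
    intro G hG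
    conv_lhs => rw [huniq]
    rw [lintegral_smul_measure, lintegral_map hG L.continuous.measurable,
      lintegral_prod (fun q => G (L q)) (hG.comp L.continuous.measurable).aemeasurable]
    rfl
  have hgL : Measurable fun q => g (L q) := hg.measurable.comp L.continuous.measurable
  have hmm : Measurable fun y => ∫⁻ w, g (L (y, w)) ∂ν := hgL.lintegral_prod_right'
  refine ⟨fun y => κ * ∫⁻ w, g (L (y, w)) ∂ν, hmm.const_mul _, ?_, ?_, ?_, ?_⟩
  · exact ((hg.logConcave.comp (e := L) (by simp)).lintegral (prekopaLeindler_addHaar ν)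
      hgL).const_mul _
  · intro y
    dsimp only
    congr 1
    rw [← lintegral_neg_eq]
    refine lintegral_congr fun w => ?_
    rw [← hg.even, ← map_neg]
    simp
  -- The fibre over 0 is ker f itself, where g is bounded with bounded support.
  · refine ENNReal.mul_ne_top ENNReal.coe_ne_top ?_
    obtain ⟨B, hB, hgB⟩ := hg.bounded
    obtain ⟨R, hR⟩ := hg.support
    have : ∫⁻ w, g (L (0, w)) ∂ν ≤ ∫⁻ w in Metric.closedBall 0 R, B ∂ν := by
      rw [← lintegral_indicator measurableSet_closedBall]
      refine lintegral_mono fun w => ?_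
      by_cases hw : g (L (0, w)) = 0
      · simp [hw]
      · have := hR _ hw
        rw [hL] at this
        simp only [map_zero, zero_add] at this
        rw [indicator_of_mem (by simpa using this)]
        exact hgB _
    refine ne_top_of_le_ne_top ?_ this
    rw [setLIntegral_const]
    exact ENNReal.mul_ne_top hB measure_closedBall_lt_top.ne
  · intro φ hφ
    have hfm : Measurable f := (LinearMap.continuous_of_finiteDimensional f).measurable
    rw [hint (fun z => φ (f z) * g z) ((hφ.comp hfm).mul hg.measurable), ← lintegral_const_mul]
    · refine lintegral_congr fun y => ?_
      have : ∀ w : LinearMap.ker f, f (L (y, w)) = y := fun w => by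
        have : f (w : E) = 0 := w.2
        simp [hL, hs, this]
      simp only [this]
      rw [lintegral_const_mul (φ y) (f := fun w => g (L (y, w))) (hgL.comp measurable_prodMk_left)]
      ring
    · exact Measurable.lintegral_prod_right'
        (f := fun q => φ (f (L q)) * g (L q))
        (((hφ.comp hfm).comp L.continuous.measurable).mul hgL)

end

/-! ### Busemann's inequality for slabs -/

theorem lintegral_eq_mul_lintegral_comp_mul {c : ℝ} (hc : 0 < c) {f : ℝ → ℝ≥0∞}
    (hf : Measurable f) : ∫⁻ x, f x = ENNReal.ofReal c * ∫⁻ x, f (c * x) := by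
  conv_lhs => rw [← Real.smul_map_volume_mul_left hc.ne', abs_of_pos hc]
  rw [lintegral_smul_measure, lintegral_map hf (measurable_const_mul c)]
  rfl

theorem lintegral_eq_two_mul_of_even {f : ℝ → ℝ≥0∞} (hf : ∀ x, f (-x) = f x) :
    ∫⁻ x, f x = 2 * ∫⁻ x in Ioi 0, f x := by
  have h1 : ∫⁻ x in Iic 0, f x = ∫⁻ x in Ioi 0, f x := by
    rw [← lintegral_indicator measurableSet_Iic, ← lintegral_indicator measurableSet_Ioi,
      ← lintegral_neg_eq]
    refine lintegral_congr_ae ?_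
    filter_upwards [Measure.ae_ne volume (0 : ℝ)] with x hx
    rcases lt_or_gt_of_ne hx with h | h
    · simp [h.not_ge, h.le]
    · simp [h, h.le, hf]
  rw [← lintegral_add_compl f measurableSet_Ioi, compl_Ioi, h1, two_mul]

/-- Tonelli, then translation invariance in t absorbs the shear cσ, and a = Sσ produces the factor
1/S. -/
theorem lintegral_strip_average {Ψ : ℝ × ℝ → ℝ≥0∞} (hΨ : Measurable Ψ) {S : ℝ} (hS : 0 < S)
    (c : ℝ) :
    ∫⁻ t : ℝ, ∫⁻ σ : ℝ, (Icc (-1) 1).indicator 1 σ * Ψ (S * σ, t + c * σ) =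
      (ENNReal.ofReal S)⁻¹ * ∫⁻ a : ℝ, ∫⁻ t : ℝ, (Icc (-S) S).indicator 1 a * Ψ (a, t) := by
  have m1 : Measurable ((Icc (-1 : ℝ) 1).indicator (1 : ℝ → ℝ≥0∞)) :=
    measurable_one.indicator measurableSet_Icc
  have m2 : Measurable ((Icc (-S : ℝ) S).indicator (1 : ℝ → ℝ≥0∞)) :=
    measurable_one.indicator measurableSet_Icc
  have hin : Measurable fun a : ℝ => ∫⁻ t : ℝ, (Icc (-S) S).indicator 1 a * Ψ (a, t) :=
    Measurable.lintegral_prod_right' (f := fun q : ℝ × ℝ => (Icc (-S) S).indicator 1 q.1 * Ψ q)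
      ((m2.comp measurable_fst).mul hΨ)
  rw [lintegral_lintegral_swap, lintegral_eq_mul_lintegral_comp_mul hS hin, ← mul_assoc,
    ENNReal.inv_mul_cancel (by simpa using hS) ENNReal.ofReal_ne_top, one_mul]
  · refine lintegral_congr fun σ => ?_
    have e : (Icc (-S) S).indicator (1 : ℝ → ℝ≥0∞) (S * σ) = (Icc (-1) 1).indicator 1 σ := by
      have : S * σ ∈ Icc (-S) S ↔ σ ∈ Icc (-1 : ℝ) 1 := by
        constructor
        · rintro ⟨h1, h2⟩
          constructor <;> nlinarith
        · rintro ⟨h1, h2⟩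
          constructor <;> nlinarith
      by_cases h : σ ∈ Icc (-1 : ℝ) 1
      · rw [indicator_of_mem h, indicator_of_mem (this.2 h)]; rfl
      · rw [indicator_of_notMem h, indicator_of_notMem (fun h' => h (this.1 h'))]
    simp only [e]
    exact lintegral_add_right_eq_self (fun t => (Icc (-1) 1).indicator 1 σ * Ψ (S * σ, t)) (c * σ)
  · refine Measurable.aemeasurable ?_
    refine (m1.comp measurable_snd).mul (hΨ.comp ?_)
    fun_prop

/-- Busemann's inequality for the masses of slabs with respect to an even log-concave density in
the plane. -/
theorem slab_inequality {m : ℝ × ℝ → ℝ≥0∞} (hm : Measurable m) (hlc : LogConcave m)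
    (heven : ∀ y, m (-y) = m y) {s₁ s₂ : ℝ} (h₁ : 0 < s₁) (h₂ : 0 < s₂)
    (hfin : ∫⁻ y, m y ≠ ∞)
    (hA : ∫⁻ y : ℝ × ℝ, (Icc (-s₁) s₁).indicator 1 y.1 * m y ≠ 0)
    (hB : ∫⁻ y : ℝ × ℝ, (Icc (-s₂) s₂).indicator 1 y.2 * m y ≠ 0) :
    ((ENNReal.ofReal (s₁ + s₂))⁻¹ *
        ∫⁻ y : ℝ × ℝ, (Icc (-(s₁ + s₂)) (s₁ + s₂)).indicator 1 (y.1 + y.2) * m y)⁻¹ ≤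
      ((ENNReal.ofReal s₁)⁻¹ * ∫⁻ y : ℝ × ℝ, (Icc (-s₁) s₁).indicator 1 y.1 * m y)⁻¹ +
      ((ENNReal.ofReal s₂)⁻¹ * ∫⁻ y : ℝ × ℝ, (Icc (-s₂) s₂).indicator 1 y.2 * m y)⁻¹ := by
  have m1 : ∀ S : ℝ, Measurable ((Icc (-S) S).indicator (1 : ℝ → ℝ≥0∞)) := fun S =>
    measurable_one.indicator measurableSet_Icc
  -- The density is smeared along the segment [-1,1]·(s₁, s₂). Then h is even and log-concave, and
  -- its integrals along the lines through (0,1), (-1,0) and (-1,1) are exactly the three normalised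
  -- slab masses.
  set h : ℝ × ℝ → ℝ≥0∞ := fun y =>
    ∫⁻ σ : ℝ, (Icc (-1) 1).indicator 1 σ * m (y.1 + s₁ * σ, y.2 + s₂ * σ) with hh
  have hlc_h : LogConcave h := by
    refine LogConcave.lintegral (f := fun q : (ℝ × ℝ) × ℝ =>
      (Icc (-1) 1).indicator 1 q.2 * m (q.1.1 + s₁ * q.2, q.1.2 + s₂ * q.2))
      prekopaLeindler_real ?_ ?_
    · refine LogConcave.mul ?_ ?_
      · exact (convex_Icc (-1 : ℝ) 1).logConcave_indicator.comp (e := Prod.snd) (by simp)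
      · refine hlc.comp (e := fun q : (ℝ × ℝ) × ℝ => (q.1.1 + s₁ * q.2, q.1.2 + s₂ * q.2)) ?_
        intro a b x y
        ext <;> simp <;> ring
    · refine ((measurable_one.indicator measurableSet_Icc).comp measurable_snd).mul (hm.comp ?_)
      fun_prop
  have heven_h : ∀ y, h (-y) = h y := by
    intro y
    simp only [hh]
    rw [← lintegral_neg_eq]
    refine lintegral_congr fun σ => ?_
    have e1 : (Icc (-1 : ℝ) 1).indicator (1 : ℝ → ℝ≥0∞) (-σ) = (Icc (-1) 1).indicator 1 σ := by
      simp only [indicator, mem_Icc, neg_le, neg_neg, and_comm, Pi.one_apply]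
    rw [e1, ← heven]
    congr 2
    ext <;> simp <;> ring
  have hanti : ∀ w : ℝ × ℝ, AntitoneOn (fun r : ℝ => h (r • w)) (Ioi 0) := by
    intro w a ha b hb hab
    have ha' : 0 < a := ha
    have hb' : 0 < b := hb
    have := hlc_h.le_smul heven_h (b • w) (t := a / b) (by positivity) (by rwa [div_le_one hb'])
    rwa [smul_smul, div_mul_cancel₀ _ hb'.ne'] at this
  have hline : ∀ w : ℝ × ℝ, ∫⁻ t : ℝ, h (t • w) = 2 * ∫⁻ r in Ioi (0 : ℝ), h (r • w) := fun w =>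
    lintegral_eq_two_mul_of_even fun t => by rw [neg_smul, heven_h]
  -- the three line integrals
  have l1 : ∫⁻ t : ℝ, h (t • ((0 : ℝ), (1 : ℝ))) =
      (ENNReal.ofReal s₁)⁻¹ * ∫⁻ y : ℝ × ℝ, (Icc (-s₁) s₁).indicator 1 y.1 * m y := by
    have := lintegral_strip_average hm h₁ s₂
    rw [← lintegral_prod (fun y : ℝ × ℝ => (Icc (-s₁) s₁).indicator 1 y.1 * m y)
      (((m1 s₁).comp measurable_fst).mul hm).aemeasurable, ← Measure.volume_eq_prod] at this
    rw [← this]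
    simp [hh]
  have l2 : ∫⁻ t : ℝ, h (t • ((-1 : ℝ), (0 : ℝ))) =
      (ENNReal.ofReal s₂)⁻¹ * ∫⁻ y : ℝ × ℝ, (Icc (-s₂) s₂).indicator 1 y.2 * m y := by
    have := lintegral_strip_average (Ψ := fun q => m (q.2, q.1)) (hm.comp measurable_swap) h₂ s₁
    rw [← lintegral_prod_symm (fun y : ℝ × ℝ => (Icc (-s₂) s₂).indicator 1 y.2 * m y)
      (((m1 s₂).comp measurable_snd).mul hm).aemeasurable, ← Measure.volume_eq_prod] at this
    rw [← this, ← lintegral_neg_eq]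
    simp [hh]
  have l3 : ∫⁻ t : ℝ, h (t • ((-1 : ℝ), (1 : ℝ))) =
      (ENNReal.ofReal (s₁ + s₂))⁻¹ *
        ∫⁻ y : ℝ × ℝ, (Icc (-(s₁ + s₂)) (s₁ + s₂)).indicator 1 (y.1 + y.2) * m y := by
    have := lintegral_strip_average (Ψ := fun q => m (q.1 - q.2, q.2))
      (hm.comp (by fun_prop)) (add_pos h₁ h₂) s₂
    have e : ∫⁻ a : ℝ, ∫⁻ t : ℝ,
        (Icc (-(s₁ + s₂)) (s₁ + s₂)).indicator 1 a * m (a - t, t) =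
        ∫⁻ y : ℝ × ℝ, (Icc (-(s₁ + s₂)) (s₁ + s₂)).indicator 1 (y.1 + y.2) * m y := by
      rw [Measure.volume_eq_prod, lintegral_prod_symm (fun y : ℝ × ℝ =>
        (Icc (-(s₁ + s₂)) (s₁ + s₂)).indicator 1 (y.1 + y.2) * m y)
        (((m1 _).comp (measurable_fst.add measurable_snd)).mul hm).aemeasurable,
        lintegral_lintegral_swap]
      · refine lintegral_congr fun t => ?_
        rw [← lintegral_add_right_eq_self _ t]
        simp
      · exact (((m1 _).comp measurable_fst).mul (hm.comp (by fun_prop))).aemeasurable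
    rw [← e, ← this]
    refine lintegral_congr fun t => ?_
    simp only [hh]
    refine lintegral_congr fun σ => ?_
    congr 2
    ext <;> simp
    ring
  have hind : ∀ (S x : ℝ), (Icc (-S) S).indicator (1 : ℝ → ℝ≥0∞) x ≤ 1 := fun S x =>
    indicator_le_self' (fun _ _ => zero_le) x
  have hfin' : ∀ (S : ℝ) (ℓ : ℝ × ℝ → ℝ),
      ∫⁻ y : ℝ × ℝ, (Icc (-S) S).indicator 1 (ℓ y) * m y ≠ ∞ := fun S ℓ =>
    ne_top_of_le_ne_top hfin (lintegral_mono fun y => mul_le_of_le_one_left zero_le (hind S _))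
  rw [← l1, ← l2, ← l3, hline, hline, hline]
  have nt : ∀ (S : ℝ) (X : ℝ≥0∞), 0 < S → X ≠ ∞ → (ENNReal.ofReal S)⁻¹ * X ≠ ∞ := fun S X hS hX =>
    ENNReal.mul_ne_top (by simpa using hS) hX
  have nz : ∀ (S : ℝ) (X : ℝ≥0∞), X ≠ 0 → (ENNReal.ofReal S)⁻¹ * X ≠ 0 := fun S X hX =>
    mul_ne_zero (by simp) hX
  have t1 := l1 ▸ nt s₁ _ h₁ (hfin' s₁ Prod.fst)
  have t2 := l2 ▸ nt s₂ _ h₂ (hfin' s₂ Prod.snd)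
  have z1 := l1 ▸ nz s₁ _ hA
  have z2 := l2 ▸ nz s₂ _ hB
  rw [hline] at t1 t2 z1 z2
  have half : ∀ X : ℝ≥0∞, 2 * X ≠ ∞ → X ≠ ∞ := fun X hX h => hX (by simp [h])
  have key := lintegral_inv_le_of_logConcave (f₃ := fun r => h (r • ((-1 : ℝ), (1 : ℝ))))
    (hanti _) (hanti _) (half _ t1) (half _ t2)
    (right_ne_zero_of_mul z1) (right_ne_zero_of_mul z2) (by
      intro r₁ r₂ hr₁ hr₂
      -- With these weights, r₁(0,1) and r₂(-1,0) combine to r₁r₂/(r₁ + r₂)·(-1,1).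
      refine (hlc_h (r₂ / (r₁ + r₂)) (r₁ / (r₁ + r₂)) (by positivity) (by positivity)
        (by field_simp; ring) _ _).trans_eq ?_
      congr 1
      ext <;> simp <;> field_simp)
  rw [ENNReal.mul_inv (by simp) (by simp), ENNReal.mul_inv (by simp) (by simp),
    ENNReal.mul_inv (by simp) (by simp), ← mul_add]
  gcongr

/-! ### Negative moments of log-concave functions -/

section

variable {E : Type*} [NormedAddCommGroup E] [InnerProductSpace ℝ E]

theorem surjective_inner {u : E} (hu : u ≠ 0) :
    Function.Surjective ((innerSL ℝ u : E →L[ℝ] ℝ) : E →ₗ[ℝ] ℝ) := by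
  intro a
  refine ⟨(a / ⟪u, u⟫) • u, ?_⟩
  have : ⟪u, u⟫ ≠ 0 := inner_self_ne_zero.2 hu
  simp only [ContinuousLinearMap.coe_coe, innerSL_apply_apply, inner_smul_right]
  field_simp

theorem surjective_inner_prod {u v : E} (hu : u ≠ 0) (hv : ∀ c : ℝ, v ≠ c • u) :
    Function.Surjective (((innerSL ℝ u : E →L[ℝ] ℝ) : E →ₗ[ℝ] ℝ).prod
      ((innerSL ℝ v : E →L[ℝ] ℝ) : E →ₗ[ℝ] ℝ)) := by
  have huu : ⟪u, u⟫ ≠ 0 := inner_self_ne_zero.2 hu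
  -- Gram–Schmidt: w is orthogonal to u and non-zero, so the system in the basis u, w is triangular.
  set w : E := v - (⟪u, v⟫ / ⟪u, u⟫) • u with hw
  have hw0 : w ≠ 0 := fun h => hv _ (sub_eq_zero.1 h)
  have huw : ⟪u, w⟫ = 0 := by
    rw [hw, inner_sub_right, inner_smul_right]
    field_simp
    simp
  have hvw : ⟪v, w⟫ = ⟪w, w⟫ := by
    have : v = w + (⟪u, v⟫ / ⟪u, u⟫) • u := by rw [hw]; abel
    conv_lhs => rw [this]
    rw [inner_add_left, inner_smul_left, huw]
    simp
  have hww : ⟪w, w⟫ ≠ 0 := inner_self_ne_zero.2 hw0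
  rintro ⟨a, b⟩
  refine ⟨(a / ⟪u, u⟫) • u + ((b - a / ⟪u, u⟫ * ⟪v, u⟫) / ⟪w, w⟫) • w, ?_⟩
  simp only [LinearMap.prod_apply, Function.prod_apply, ContinuousLinearMap.coe_coe,
    innerSL_apply_apply, inner_add_right, inner_smul_right, huw, hvw]
  ext
  · simp only; field_simp; ring
  · simp only; field_simp; ring

end

section

variable {E : Type*} [NormedAddCommGroup E] [InnerProductSpace ℝ E] [FiniteDimensional ℝ E]
  [MeasurableSpace E] [BorelSpace E]

/-- The mean over the slab `{z | |⟪u, z⟫| ≤ t}` of `g`, relative to the half-width of the slab. -/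
noncomputable def slabRatio (g : E → ℝ≥0∞) (u : E) (t : ℝ) : ℝ≥0∞ :=
  (ENNReal.ofReal t)⁻¹ * ∫⁻ z, (Icc (-t) t).indicator 1 ⟪u, z⟫ * g z

/-- The integral `∫ |⟪u, z⟫|^(-p) g(z) dz`. -/
noncomputable def negMoment (g : E → ℝ≥0∞) (p : ℝ) (u : E) : ℝ≥0∞ :=
  ∫⁻ z, ENNReal.ofReal |⟪u, z⟫| ^ (-p) * g z

theorem measurable_indicator_Icc (t : ℝ) :
    Measurable ((Icc (-t) t).indicator (1 : ℝ → ℝ≥0∞)) :=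
  measurable_one.indicator measurableSet_Icc

theorem measurable_ofReal_abs_rpow (p : ℝ) :
    Measurable fun x : ℝ => ENNReal.ofReal |x| ^ p :=
  ((ENNReal.measurable_ofReal.comp measurable_id.abs).pow_const p)

theorem indicator_one_le_one (s : Set ℝ) (x : ℝ) : s.indicator (1 : ℝ → ℝ≥0∞) x ≤ 1 :=
  indicator_le_self' (fun _ _ => zero_le) x

variable {g : E → ℝ≥0∞}

theorem IsLogConcaveBump.lintegral_ne_top (hg : IsLogConcaveBump g) : ∫⁻ z, g z ≠ ∞ := by
  obtain ⟨B, hB, hgB⟩ := hg.bounded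
  obtain ⟨R, hR⟩ := hg.support
  have : ∫⁻ z, g z ≤ ∫⁻ z in Metric.closedBall (0 : E) R, B := by
    rw [← lintegral_indicator measurableSet_closedBall]
    refine lintegral_mono fun z => ?_
    by_cases hz : g z = 0
    · simp [hz]
    · rw [indicator_of_mem (by simpa using hR z hz)]
      exact hgB _
  refine ne_top_of_le_ne_top ?_ this
  rw [setLIntegral_const]
  exact ENNReal.mul_ne_top hB measure_closedBall_lt_top.ne

theorem IsLogConcaveBump.setLIntegral_ball_ne_zero (hg : IsLogConcaveBump g) {r : ℝ} (hr : 0 < r) :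
    ∫⁻ z in Metric.ball 0 r, g z ≠ 0 := by
  obtain ⟨δ, hδ, c, hc, hcg⟩ := hg.pos
  have h1 : ∫⁻ z in Metric.ball (0 : E) (min δ r), c ≤ ∫⁻ z in Metric.ball 0 r, g z :=
    calc _ ≤ ∫⁻ z in Metric.ball (0 : E) (min δ r), g z :=
          setLIntegral_mono' measurableSet_ball fun z hz =>
            hcg z (by have := (mem_ball_zero_iff.1 hz); exact this.trans_le (min_le_left _ _))
      _ ≤ _ := lintegral_mono_set (Metric.ball_subset_ball (min_le_right _ _))
  rw [setLIntegral_const] at h1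
  have h2 : c * volume (Metric.ball (0 : E) (min δ r)) ≠ 0 :=
    mul_ne_zero hc (Metric.measure_ball_pos _ _ (lt_min hδ hr)).ne'
  exact fun h => h2 (le_antisymm (h1.trans_eq h) zero_le)

theorem IsLogConcaveBump.lintegral_slab_ne_zero (hg : IsLogConcaveBump g) (u : E) {t : ℝ}
    (ht : 0 < t) : ∫⁻ z, (Icc (-t) t).indicator 1 ⟪u, z⟫ * g z ≠ 0 := by
  have hr : 0 < t / (‖u‖ + 1) := by positivity
  refine fun h => hg.setLIntegral_ball_ne_zero hr (le_antisymm ?_ zero_le)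
  rw [← h, ← lintegral_indicator measurableSet_ball]
  refine lintegral_mono fun z => ?_
  by_cases hz : z ∈ Metric.ball 0 (t / (‖u‖ + 1))
  · rw [indicator_of_mem hz]
    have hz' : ‖z‖ < t / (‖u‖ + 1) := mem_ball_zero_iff.1 hz
    have h1 : |⟪u, z⟫| ≤ t := by
      refine (abs_real_inner_le_norm u z).trans ?_
      rw [lt_div_iff₀ (by positivity)] at hz'
      nlinarith [norm_nonneg z, norm_nonneg u]
    rw [indicator_of_mem (show ⟪u, z⟫ ∈ Icc (-t) t from abs_le.1 h1)]
    simp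
  · rw [indicator_of_notMem hz]
    exact zero_le

theorem IsLogConcaveBump.lintegral_slab_le (u : E) (t : ℝ) :
    ∫⁻ z, (Icc (-t) t).indicator 1 ⟪u, z⟫ * g z ≤ ∫⁻ z, g z :=
  lintegral_mono fun _ => mul_le_of_le_one_left zero_le (indicator_one_le_one _ _)

/-- The image of g under ⟨u,·⟩ has an even log-concave density d, hence one non-increasing in |y|,
and rescaling the slab writes the ratio as ∫_{-1}^{1} d(ty) dy. -/
theorem IsLogConcaveBump.antitoneOn_slabRatio (hg : IsLogConcaveBump g) {u : E} (hu : u ≠ 0) :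
    AntitoneOn (slabRatio g u) (Ioi 0) := by
  obtain ⟨d, hdm, hlc, heven, -, hd⟩ := hg.exists_density volume _ (surjective_inner hu)
  simp only [ContinuousLinearMap.coe_coe, innerSL_apply_apply] at hd
  have key : ∀ t : ℝ, 0 < t →
      slabRatio g u t = ∫⁻ y, (Icc (-1) 1).indicator 1 y * d (t * y) := by
    intro t ht
    rw [slabRatio, hd _ (measurable_indicator_Icc t),
      lintegral_eq_mul_lintegral_comp_mul ht (f := fun y => (Icc (-t) t).indicator 1 y * d y)
        ((measurable_indicator_Icc t).mul hdm), ← mul_assoc,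
      ENNReal.inv_mul_cancel (by simpa using ht) ENNReal.ofReal_ne_top, one_mul]
    refine lintegral_congr fun y => ?_
    congr 1
    have : t * y ∈ Icc (-t) t ↔ y ∈ Icc (-1 : ℝ) 1 := by
      constructor
      · rintro ⟨h1, h2⟩
        constructor <;> nlinarith
      · rintro ⟨h1, h2⟩
        constructor <;> nlinarith
    simp only [indicator, this, Pi.one_apply]
  intro s hs t ht hst
  rw [key s hs, key t ht]
  refine lintegral_mono fun y => ?_
  gcongr
  have ht' : 0 < t := ht
  have hs' : 0 < s := hs
  have := hlc.le_smul heven (t * y) (t := s / t) (by positivity) (by rwa [div_le_one ht'])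
  rwa [smul_eq_mul, ← mul_assoc, div_mul_cancel₀ _ ht'.ne'] at this

/-- The map (⟨u,·⟩, ⟨v,·⟩) is onto the plane by linear independence, so the image of g has a
log-concave density there and `slab_inequality` applies. -/
theorem IsLogConcaveBump.slabRatio_add (hg : IsLogConcaveBump g) {u v : E} (hu : u ≠ 0)
    (hv : ∀ c : ℝ, v ≠ c • u) {s t : ℝ} (hs : 0 < s) (ht : 0 < t) :
    (slabRatio g (u + v) (s + t))⁻¹ ≤ (slabRatio g u s)⁻¹ + (slabRatio g v t)⁻¹ := by
  obtain ⟨m, hmm, hlc, heven, -, hm⟩ := hg.exists_density (volume : Measure (ℝ × ℝ)) _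
    (surjective_inner_prod hu hv)
  simp only [LinearMap.prod_apply, Function.prod_apply, ContinuousLinearMap.coe_coe,
    innerSL_apply_apply] at hm
  have e1 := hm (fun y => (Icc (-s) s).indicator 1 y.1)
    ((measurable_indicator_Icc s).comp measurable_fst)
  have e2 := hm (fun y => (Icc (-t) t).indicator 1 y.2)
    ((measurable_indicator_Icc t).comp measurable_snd)
  have e3 := hm (fun y => (Icc (-(s + t)) (s + t)).indicator 1 (y.1 + y.2))
    ((measurable_indicator_Icc (s + t)).comp (measurable_fst.add measurable_snd))
  have e4 := hm (fun _ => 1) measurable_const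
  simp only [one_mul] at e4
  have n1 := hg.lintegral_slab_ne_zero u hs
  have n2 := hg.lintegral_slab_ne_zero v ht
  rw [e1] at n1
  rw [e2] at n2
  have := slab_inequality hmm hlc heven hs ht (e4 ▸ hg.lintegral_ne_top) n1 n2
  rw [← e1, ← e2, ← e3] at this
  simpa only [slabRatio, inner_add_left] using this

/-- The weight |⟨u,z⟩|^(-p) vanishes nowhere, so a zero moment would force g = 0 almost everywhere.
-/
theorem IsLogConcaveBump.negMoment_ne_zero (hg : IsLogConcaveBump g) {p : ℝ} (hp : 0 < p) (u : E) :
    negMoment g p u ≠ 0 := by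
  intro h
  have hm : Measurable fun z => ENNReal.ofReal |⟪u, z⟫| ^ (-p) * g z :=
    ((measurable_ofReal_abs_rpow (-p)).comp (by fun_prop : Measurable fun z => ⟪u, z⟫)).mul
      hg.measurable
  rw [negMoment, lintegral_eq_zero_iff hm] at h
  refine hg.setLIntegral_ball_ne_zero one_pos ?_
  refine le_antisymm ((setLIntegral_le_lintegral _ _).trans_eq ?_) zero_le
  rw [lintegral_eq_zero_iff hg.measurable]
  filter_upwards [h] with z hz
  simp only [Pi.zero_apply, mul_eq_zero] at hz ⊢
  refine hz.resolve_left ?_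
  rw [ENNReal.rpow_neg]
  simp [hp, hp.le]

/-- In the one-dimensional density d, the singularity |y|^(-p) is integrable near 0 because p < 1
and d ≤ d(0) < ∞; beyond 1 the weight is at most 1 and the mass is finite. -/
theorem IsLogConcaveBump.negMoment_ne_top (hg : IsLogConcaveBump g) {p : ℝ} (hp0 : 0 < p)
    (hp1 : p < 1) {u : E} (hu : u ≠ 0) : negMoment g p u ≠ ∞ := by
  obtain ⟨d, hdm, hlc, heven, hd0, hd⟩ := hg.exists_density volume _ (surjective_inner hu)
  simp only [ContinuousLinearMap.coe_coe, innerSL_apply_apply] at hd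
  have hd1 : ∀ y, d y ≤ d 0 := fun y => by
    simpa using hlc.le_smul heven y le_rfl zero_le_one
  have htot : ∫⁻ y, d y ≠ ∞ := by
    have := hd (fun _ => 1) measurable_const
    simp only [one_mul] at this
    rw [← this]
    exact hg.lintegral_ne_top
  have hsing : ∫⁻ y in Ioc (0 : ℝ) 1, ENNReal.ofReal |y| ^ (-p) ≠ ∞ := by
    have hi : IntegrableOn (fun y : ℝ => y ^ (-p)) (Ioc 0 1) := by
      have := intervalIntegral.intervalIntegrable_rpow' (a := 0) (b := 1)
        (by linarith : -1 < -p)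
      rwa [intervalIntegrable_iff_integrableOn_Ioc_of_le zero_le_one] at this
    have := hi.lintegral_lt_top.ne
    rwa [setLIntegral_congr_fun (g := fun y : ℝ => ENNReal.ofReal |y| ^ (-p)) measurableSet_Ioc]
      at this
    intro y hy
    dsimp only
    rw [abs_of_pos hy.1, ENNReal.ofReal_rpow_of_pos hy.1]
  rw [negMoment, hd _ (measurable_ofReal_abs_rpow (-p)), lintegral_eq_two_mul_of_even
    (fun y => by rw [heven, abs_neg])]
  refine ENNReal.mul_ne_top (by simp) ?_
  rw [← Ioc_union_Ioi_eq_Ioi (zero_le_one' ℝ)]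
  refine ne_top_of_le_ne_top ?_ (lintegral_union_le _ _ _)
  refine ENNReal.add_ne_top.2 ⟨?_, ?_⟩
  · refine ne_top_of_le_ne_top ?_ (lintegral_mono fun y => mul_le_mul_right (hd1 y) _)
    rw [lintegral_mul_const _ (measurable_ofReal_abs_rpow (-p))]
    exact ENNReal.mul_ne_top hsing hd0
  · refine ne_top_of_le_ne_top htot (le_trans ?_ (setLIntegral_le_lintegral (Ioi 1) _))
    refine setLIntegral_mono' measurableSet_Ioi fun y hy => ?_
    refine mul_le_of_le_one_left zero_le ?_
    have hy' : (1 : ℝ) < y := hy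
    rw [ENNReal.rpow_neg, ENNReal.inv_le_one]
    refine ENNReal.one_le_rpow ?_ hp0
    rw [abs_of_pos (by linarith)]
    simpa using hy'.le

theorem negMoment_smul (p : ℝ) {c : ℝ} (hc : c ≠ 0) (u : E) (hgm : Measurable g) :
    negMoment g p (c • u) = ENNReal.ofReal |c| ^ (-p) * negMoment g p u := by
  rw [negMoment, negMoment, ← lintegral_const_mul]
  · refine lintegral_congr fun z => ?_
    have hc' : ENNReal.ofReal |c| ≠ 0 := by simpa using hc
    rw [real_inner_smul_left, abs_mul, ENNReal.ofReal_mul (abs_nonneg _), ← mul_assoc]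
    congr 1
    -- On the hyperplane orthogonal to u the power is 0, 1 or ∞ according to the sign of p, and the
    -- non-zero finite factor |c|^(-p) does not change 0 or ∞.
    by_cases hz : ENNReal.ofReal |⟪u, z⟫| = 0
    · rcases lt_trichotomy p 0 with hp | rfl | hp
      · rw [hz, mul_zero, ENNReal.zero_rpow_of_pos (by linarith), mul_zero]
      · simp
      · rw [hz, mul_zero, ENNReal.zero_rpow_of_neg (by linarith), ENNReal.mul_top]
        rw [ENNReal.rpow_neg]
        simp [hp.le]
    · exact ENNReal.mul_rpow_of_ne_zero hc' hz _
  · exact ((measurable_ofReal_abs_rpow (-p)).comp (by fun_prop : Measurable fun z => ⟪u, z⟫)).mul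
      hgm

/-! ### The layer-cake formula for negative moments -/

theorem setLIntegral_Ioo_rpow {p T : ℝ} (hp1 : p < 1) (hT : 0 < T) (hp0 : 0 < p) :
    ∫⁻ t in Ioo 0 T, ENNReal.ofReal (p * t ^ (-p)) =
      ENNReal.ofReal (p / (1 - p)) * ENNReal.ofReal (T ^ (1 - p)) := by
  have hi := intervalIntegral.intervalIntegrable_rpow' (a := 0) (b := T) (by linarith : -1 < -p)
  rw [Measure.restrict_congr_set Ioo_ae_eq_Ioc, ← ofReal_integral_eq_lintegral_ofReal,
    ← intervalIntegral.integral_of_le hT.le, intervalIntegral.integral_const_mul,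
    integral_rpow (Or.inl (by linarith)), ← ENNReal.ofReal_mul (by
      have := sub_pos.2 hp1; positivity)]
  · congr 1
    rw [Real.zero_rpow (by linarith), sub_zero, show -p + 1 = 1 - p by ring]
    ring
  · rw [intervalIntegrable_iff_integrableOn_Ioc_of_le hT.le] at hi
    exact hi.const_mul p
  · filter_upwards [ae_restrict_mem measurableSet_Ioc] with t ht
    have := ht.1
    positivity

/-- Any t in the set satisfies tr ≤ M. Boundedness is what makes the real supremum meaningful. -/
theorem bddAbove_superlevel {Q : ℝ → ℝ≥0∞} {M : ℝ≥0∞} (hM : M ≠ ∞)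
    (hQM : ∀ t, 0 < t → Q t ≤ (ENNReal.ofReal t)⁻¹ * M) {r : ℝ} (hr : 0 < r) :
    BddAbove {t | 0 < t ∧ ENNReal.ofReal r < Q t} := by
  refine ⟨M.toReal / r, ?_⟩
  rintro t ⟨ht, hrt⟩
  rw [le_div_iff₀ hr]
  have h1 : ENNReal.ofReal t * ENNReal.ofReal r ≤ M := by
    have := hrt.le.trans (hQM t ht)
    calc _ ≤ ENNReal.ofReal t * ((ENNReal.ofReal t)⁻¹ * M) := by gcongr
      _ = M := by
        rw [← mul_assoc, ENNReal.mul_inv_cancel (by simpa using ht) ENNReal.ofReal_ne_top, one_mul]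
  rw [← ENNReal.ofReal_mul ht.le] at h1
  exact (ENNReal.ofReal_le_iff_le_toReal hM).1 h1

/-- Layer cake with respect to the measure p t^(-p) dt: superlevel sets of a non-increasing Q are
intervals starting at 0, so their measure depends only on their supremum. -/
theorem lintegral_rpow_mul_antitone {Q : ℝ → ℝ≥0∞} (hQ : Measurable Q) (hQa : AntitoneOn Q (Ioi 0))
    {M : ℝ≥0∞} (hM : M ≠ ∞) (hQM : ∀ t, 0 < t → Q t ≤ (ENNReal.ofReal t)⁻¹ * M) {p : ℝ}
    (hp0 : 0 < p) (hp1 : p < 1) :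
    ∫⁻ t in Ioi 0, ENNReal.ofReal (p * t ^ (-p)) * Q t =
      ENNReal.ofReal (p / (1 - p)) * ∫⁻ r in Ioi (0 : ℝ),
        ENNReal.ofReal (sSup {t | 0 < t ∧ ENNReal.ofReal r < Q t} ^ (1 - p)) := by
  have hw : Measurable fun t : ℝ => ENNReal.ofReal (p * t ^ (-p)) := by fun_prop
  set ν : Measure ℝ := (volume.restrict (Ioi 0)).withDensity fun t => ENNReal.ofReal (p * t ^ (-p))
    with hν
  have e1 : ∫⁻ t in Ioi 0, ENNReal.ofReal (p * t ^ (-p)) * Q t = ∫⁻ t, Q t ∂ν := by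
    rw [hν, lintegral_withDensity_eq_lintegral_mul _ hw hQ]
    rfl
  rw [e1, lintegral_eq_lintegral_meas_ofReal_lt _ hQ, ← lintegral_const_mul' _ _ (by simp)]
  refine setLIntegral_congr_fun measurableSet_Ioi fun r hr => ?_
  have hms : MeasurableSet {t | ENNReal.ofReal r < Q t} := measurableSet_lt measurable_const hQ
  have hset : {t | ENNReal.ofReal r < Q t} ∩ Ioi 0 = {t | 0 < t ∧ ENNReal.ofReal r < Q t} := by
    ext t; simp [and_comm]
  have hb := bddAbove_superlevel hM hQM hr
  rw [hν, withDensity_apply _ hms, Measure.restrict_restrict hms, hset]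
  set S := {t | 0 < t ∧ ENNReal.ofReal r < Q t} with hS
  rcases S.eq_empty_or_nonempty with hSe | hSn
  -- Here `sSup ∅ = 0` and 0^(1-p) = 0, the correct measure of the empty set.
  · rw [hSe]
    simp [Real.zero_rpow (by linarith : 1 - p ≠ 0)]
  · have hT : 0 < sSup S := by
      obtain ⟨t, ht⟩ := hSn
      exact ht.1.trans_le (le_csSup hb ht)
    rw [← setLIntegral_Ioo_rpow hp1 hT hp0]
    refine setLIntegral_congr ?_
    have h1 : Ioo 0 (sSup S) ⊆ S := by
      intro t ht
      obtain ⟨s, hs, hts⟩ := exists_lt_of_lt_csSup hSn ht.2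
      exact ⟨ht.1, hs.2.trans_le (hQa ht.1 hs.1 hts.le)⟩
    have h2 : S ⊆ Ioc 0 (sSup S) := fun t ht => ⟨ht.1, le_csSup hb ht⟩
    exact (LE.le.eventuallyLE h2 |>.trans
      (Ioo_ae_eq_Ioc (μ := volume)).symm.le).antisymm (LE.le.eventuallyLE h1)

theorem lintegral_rpow_Ici {p x : ℝ} (hp0 : 0 < p) (hx : 0 < x) :
    ∫⁻ t in Ioi 0, ENNReal.ofReal (p * t ^ (-p - 1)) * (Ici x).indicator 1 t =
      ENNReal.ofReal x ^ (-p) := by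
  have hlt : -p - 1 < -1 := by linarith
  have e : ∀ t : ℝ, ENNReal.ofReal (p * t ^ (-p - 1)) * (Ici x).indicator 1 t =
      (Ici x).indicator (fun t => ENNReal.ofReal (p * t ^ (-p - 1))) t := fun t => by
    by_cases ht : t ∈ Ici x <;> simp [ht]
  simp only [e]
  rw [setLIntegral_indicator measurableSet_Ici, inter_eq_left.2 (Ici_subset_Ioi.2 hx),
    Measure.restrict_congr_set Ioi_ae_eq_Ici.symm, ← ofReal_integral_eq_lintegral_ofReal,
    integral_const_mul, integral_Ioi_rpow_of_lt hlt hx, ENNReal.ofReal_rpow_of_pos hx]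
  · congr 1
    rw [show -p - 1 + 1 = -p by ring]
    field_simp
  · exact (integrableOn_Ioi_rpow_of_lt hlt hx).const_mul p
  · filter_upwards [ae_restrict_mem measurableSet_Ioi] with t ht
    have : 0 < t := hx.trans ht
    positivity

theorem measurable_slabRatio (u : E) : Measurable (slabRatio g u) := by
  refine ENNReal.measurable_ofReal.inv.mul (Monotone.measurable fun s t hst => ?_)
  refine lintegral_mono fun z => ?_
  gcongr

/-- Two layer cakes: |y|^(-p) = ∫_{|y|}^∞ p t^(-p-1) dt turns the moment into ∫ p t^(-p) Q(t) dt
with Q the slab ratio, and `lintegral_rpow_mul_antitone` then slices Q by its values. -/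
theorem IsLogConcaveBump.negMoment_eq (hg : IsLogConcaveBump g) {p : ℝ} (hp0 : 0 < p)
    (hp1 : p < 1) {u : E} (hu : u ≠ 0) :
    negMoment g p u = ENNReal.ofReal (p / (1 - p)) * ∫⁻ r in Ioi (0 : ℝ),
        ENNReal.ofReal (sSup {t | 0 < t ∧ ENNReal.ofReal r < slabRatio g u t} ^ (1 - p)) := by
  rw [← lintegral_rpow_mul_antitone (measurable_slabRatio u) (hg.antitoneOn_slabRatio hu)
    hg.lintegral_ne_top (fun t ht => mul_le_mul_right (lintegral_slab_le u t) _) hp0 hp1]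
  obtain ⟨d, hdm, -, -, -, hd⟩ := hg.exists_density volume _ (surjective_inner hu)
  simp only [ContinuousLinearMap.coe_coe, innerSL_apply_apply] at hd
  rw [negMoment, hd _ (measurable_ofReal_abs_rpow (-p))]
  have hS : MeasurableSet {q : ℝ × ℝ | |q.1| ≤ q.2} :=
    measurableSet_le measurable_fst.abs measurable_snd
  have hF : Measurable fun q : ℝ × ℝ => ENNReal.ofReal (p * q.2 ^ (-p - 1)) *
      {q : ℝ × ℝ | |q.1| ≤ q.2}.indicator 1 q * d q.1 :=
    ((by fun_prop : Measurable fun q : ℝ × ℝ => ENNReal.ofReal (p * q.2 ^ (-p - 1))).mul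
      (measurable_one.indicator hS)).mul (hdm.comp measurable_fst)
  calc ∫⁻ y, ENNReal.ofReal |y| ^ (-p) * d y
      = ∫⁻ y, (∫⁻ t in Ioi 0, ENNReal.ofReal (p * t ^ (-p - 1)) *
          {q : ℝ × ℝ | |q.1| ≤ q.2}.indicator 1 (y, t) * d y) := by
        refine lintegral_congr_ae ?_
        filter_upwards [Measure.ae_ne volume (0 : ℝ)] with y hy
        rw [lintegral_mul_const, ← lintegral_rpow_Ici hp0 (abs_pos.2 hy)]
        · rfl
        · exact (by fun_prop : Measurable fun t : ℝ => ENNReal.ofReal (p * t ^ (-p - 1))).mul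
            ((measurable_one.indicator hS).comp measurable_prodMk_left)
    _ = ∫⁻ t in Ioi 0, (∫⁻ y, ENNReal.ofReal (p * t ^ (-p - 1)) *
          {q : ℝ × ℝ | |q.1| ≤ q.2}.indicator 1 (y, t) * d y) :=
        lintegral_lintegral_swap hF.aemeasurable
    _ = _ := by
        refine setLIntegral_congr_fun measurableSet_Ioi fun t ht => ?_
        have ht' : 0 < t := ht
        simp only [mul_assoc]
        rw [lintegral_const_mul _
          (f := fun y => {q : ℝ × ℝ | |q.1| ≤ q.2}.indicator 1 (y, t) * d y)
          (((measurable_one.indicator hS).comp measurable_prodMk_right).mul hdm), slabRatio, hd _ (measurable_indicator_Icc t),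
          ← mul_assoc, ← ENNReal.ofReal_inv_of_pos ht', ← ENNReal.ofReal_mul (by positivity)]
        congr 1
        · congr 1
          rw [Real.rpow_sub_one ht'.ne']
          ring
        · refine lintegral_congr fun y => ?_
          congr 1
          simp only [indicator, mem_ofPred_eq, mem_Icc, abs_le, Pi.one_apply]

theorem IsLogConcaveBump.negMoment_smul_rpow (hg : IsLogConcaveBump g) {p : ℝ} (hp0 : 0 < p)
    (c : ℝ) (u : E) :
    negMoment g p (c • u) ^ (-1 / p) = ENNReal.ofReal |c| * negMoment g p u ^ (-1 / p) := by
  have hneg : -1 / p < 0 := div_neg_of_neg_of_pos (by norm_num) hp0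
  rcases eq_or_ne c 0 with rfl | hc
  -- At the zero vector the weight is 0^(-p) = ∞ everywhere, and ∞^(-1/p) = 0, as a norm requires.
  · have : negMoment g p (0 : E) = ∞ := by
      have h0 : ∫⁻ z, g z ≠ 0 := fun h => hg.setLIntegral_ball_ne_zero one_pos
        (le_antisymm ((setLIntegral_le_lintegral _ _).trans_eq h) zero_le)
      simp only [negMoment, inner_zero_left, abs_zero, ENNReal.ofReal_zero]
      rw [ENNReal.zero_rpow_of_neg (neg_lt_zero.2 hp0), lintegral_const_mul _ hg.measurable,
        ENNReal.top_mul h0]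
    rw [zero_smul, this, ENNReal.top_rpow_of_neg hneg]
    simp
  · have hc' : ENNReal.ofReal |c| ≠ 0 := by simpa using hc
    have hc'' : ENNReal.ofReal |c| ^ (-p) ≠ 0 := by
      rw [ENNReal.rpow_neg]; simp [hp0, hp0.le]
    rw [negMoment_smul p hc u hg.measurable,
      ENNReal.mul_rpow_of_ne_zero hc'' (hg.negMoment_ne_zero hp0 u), ← ENNReal.rpow_mul,
      show -p * (-1 / p) = 1 by field_simp, ENNReal.rpow_one]

/-- The function `u ↦ (∫ |⟪u, z⟫|^(-p) g(z) dz)^(-1/p)` is subadditive. -/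
theorem IsLogConcaveBump.negMoment_add_le (hg : IsLogConcaveBump g) {p : ℝ} (hp0 : 0 < p)
    (hp1 : p < 1) (u v : E) :
    negMoment g p (u + v) ^ (-1 / p) ≤ negMoment g p u ^ (-1 / p) + negMoment g p v ^ (-1 / p) := by
  have hneg : -1 / p < 0 := div_neg_of_neg_of_pos (by norm_num) hp0
  rcases eq_or_ne u 0 with rfl | hu
  · rw [zero_add]
    exact le_add_self
  by_cases hv : ∃ c : ℝ, v = c • u
  · obtain ⟨c, rfl⟩ := hv
    have e : u + c • u = (1 + c) • u := by rw [add_smul, one_smul]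
    rw [e, hg.negMoment_smul_rpow hp0, hg.negMoment_smul_rpow hp0]
    calc ENNReal.ofReal |1 + c| * negMoment g p u ^ (-1 / p)
        ≤ (1 + ENNReal.ofReal |c|) * negMoment g p u ^ (-1 / p) := by
          gcongr
          rw [← ENNReal.ofReal_one, ← ENNReal.ofReal_add zero_le_one (abs_nonneg c)]
          exact ENNReal.ofReal_le_ofReal ((abs_add_le 1 c).trans_eq (by simp))
      _ = _ := by rw [add_mul, one_mul]
  push Not at hv
  have hv0 : v ≠ 0 := fun h => hv 0 (by simp [h])
  have huv : u + v ≠ 0 := fun h => hv (-1) (by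
    rw [neg_smul, one_smul]; exact (neg_eq_of_add_eq_zero_right h).symm)
  set τ : E → ℝ → ℝ := fun w r => sSup {t | 0 < t ∧ ENNReal.ofReal r < slabRatio g w t} with hτ
  set c := ENNReal.ofReal (p / (1 - p)) with hc
  have hc0 : c ≠ 0 := by
    have : 0 < p / (1 - p) := div_pos hp0 (by linarith)
    simpa [hc] using this
  have hJ : ∀ w : E, w ≠ 0 →
      negMoment g p w = c * ∫⁻ r in Ioi (0 : ℝ), ENNReal.ofReal (τ w r ^ (1 - p)) := fun w hw =>
    hg.negMoment_eq hp0 hp1 hw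
  have hJ0 : ∀ w : E, w ≠ 0 → ∫⁻ r in Ioi (0 : ℝ), ENNReal.ofReal (τ w r ^ (1 - p)) ≠ 0 :=
    fun w hw h => hg.negMoment_ne_zero hp0 w (by rw [hJ w hw, h, mul_zero])
  have hJt : ∀ w : E, w ≠ 0 → ∫⁻ r in Ioi (0 : ℝ), ENNReal.ofReal (τ w r ^ (1 - p)) ≠ ∞ :=
    fun w hw h => hg.negMoment_ne_top hp0 hp1 hw (by rw [hJ w hw, h, ENNReal.mul_top hc0])
  have hb : ∀ (w : E) (r : ℝ), 0 < r →
      BddAbove {t | 0 < t ∧ ENNReal.ofReal r < slabRatio g w t} := fun w r hr =>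
    bddAbove_superlevel hg.lintegral_ne_top
      (fun t ht => mul_le_mul_right (lintegral_slab_le w t) _) hr
  have hnn : ∀ (w : E) (r : ℝ), 0 < r → 0 ≤ τ w r := fun w r _ =>
    Real.sSup_nonneg fun t ht => ht.1.le
  have hanti : ∀ w : E, AntitoneOn (τ w) (Ioi 0) := by
    intro w a ha b hb' hab
    rcases {t | 0 < t ∧ ENNReal.ofReal b < slabRatio g w t}.eq_empty_or_nonempty with h | h
    · simp only [hτ]
      rw [h, Real.sSup_empty]
      exact hnn w a ha
    · exact csSup_le_csSup (hb w a ha) h fun t ht =>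
        ⟨ht.1, (ENNReal.ofReal_le_ofReal hab).trans_lt ht.2⟩
  have hne : ∀ (w : E) (r : ℝ), 0 < τ w r →
      {t | 0 < t ∧ ENNReal.ofReal r < slabRatio g w t}.Nonempty := by
    intro w r h
    by_contra! h'
    simp only [hτ, h', Real.sSup_empty, lt_self_iff_false] at h
  have key := lintegral_rpow_le_of_concave (t₃ := τ (u + v)) hp0 hp1 (hanti u) (hanti v) (hnn u)
    (hnn v) (hJt u hu) (hJt v hv0) (hJ0 u hu) (hJ0 v hv0) (by
      intro r₁ r₂ hr₁ hr₂ h₁ h₂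
      have hr₃ : 0 < r₁ * r₂ / (r₁ + r₂) := by positivity
      have hadd : ∀ s ∈ {t | 0 < t ∧ ENNReal.ofReal r₁ < slabRatio g u t},
          ∀ t ∈ {t | 0 < t ∧ ENNReal.ofReal r₂ < slabRatio g v t},
          s + t ≤ τ (u + v) (r₁ * r₂ / (r₁ + r₂)) := by
        rintro s ⟨hs, hs'⟩ t ⟨ht, ht'⟩
        refine le_csSup (hb _ _ hr₃) ⟨add_pos hs ht, ?_⟩
        -- In reciprocals the goal is the slab inequality, since 1/r₁ + 1/r₂ is the reciprocal of
        -- r₁r₂/(r₁ + r₂).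
        rw [← ENNReal.inv_lt_inv]
        refine (hg.slabRatio_add hu hv hs ht).trans_lt ((ENNReal.add_lt_add
          (ENNReal.inv_lt_inv.2 hs') (ENNReal.inv_lt_inv.2 ht')).trans_eq ?_)
        rw [← ENNReal.ofReal_inv_of_pos hr₁, ← ENNReal.ofReal_inv_of_pos hr₂,
          ← ENNReal.ofReal_inv_of_pos hr₃, ← ENNReal.ofReal_add (by positivity) (by positivity)]
        congr 1
        field_simp
        ring
      have h1 : ∀ t ∈ {t | 0 < t ∧ ENNReal.ofReal r₂ < slabRatio g v t},
          τ u r₁ ≤ τ (u + v) (r₁ * r₂ / (r₁ + r₂)) - t := fun t ht =>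
        csSup_le (hne u r₁ h₁) fun s hs => by linarith [hadd s hs t ht]
      have h2 : τ v r₂ ≤ τ (u + v) (r₁ * r₂ / (r₁ + r₂)) - τ u r₁ :=
        csSup_le (hne v r₂ h₂) fun t ht => by linarith [h1 t ht]
      linarith)
  rw [hJ _ huv, hJ _ hu, hJ _ hv0, ENNReal.mul_rpow_of_ne_top (by simp [hc]) (hJt u hu),
    ENNReal.mul_rpow_of_ne_top (by simp [hc]) (hJt v hv0)]
  by_cases ht : ∫⁻ r in Ioi (0 : ℝ), ENNReal.ofReal (τ (u + v) r ^ (1 - p)) = ∞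
  · exact absurd ht (hJt _ huv)
  rw [ENNReal.mul_rpow_of_ne_top (by simp [hc]) ht, ← mul_add]
  gcongr

end

/-! ### The covariogram and the convex body defined by its negative moments -/

theorem covariogram_eq_lintegral {n : ℕ} {K : Set (Euc n)} (hK : IsCompact K) (x : Euc n) :
    covariogram K x = ∫⁻ y, {q : Euc n × Euc n | q.2 ∈ K ∧ q.2 - q.1 ∈ K}.indicator 1 (x, y) := by
  have e : K ∩ (x +ᵥ K) = {y | y ∈ K ∧ y - x ∈ K} := by
    ext y
    rw [mem_inter_iff, mem_vadd_set_iff_neg_vadd_mem, vadd_eq_add, neg_add_eq_sub]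
    rfl
  have hm : MeasurableSet (K ∩ (x +ᵥ K)) := (hK.inter (hK.vadd x)).measurableSet
  rw [covariogram, ← lintegral_indicator_one hm, e]
  rfl

theorem measurableSet_covariogram {n : ℕ} {K : Set (Euc n)} (hK : IsCompact K) :
    MeasurableSet {q : Euc n × Euc n | q.2 ∈ K ∧ q.2 - q.1 ∈ K} :=
  (measurable_snd hK.measurableSet).inter
    ((measurable_snd.sub measurable_fst) hK.measurableSet)

/-- The covariogram is a marginal of the indicator of the convex set {(x,y) : y ∈ K, y - x ∈ K},
hence log-concave. -/
theorem isLogConcaveBump_covariogram {n : ℕ} {K : Set (Euc n)} (hK : IsConvexBody K) :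
    IsLogConcaveBump (covariogram K) where
  measurable := by
    have := (measurable_one.indicator
      (measurableSet_covariogram hK.isCompact)).lintegral_prod_right' (ν := volume)
      (f := {q : Euc n × Euc n | q.2 ∈ K ∧ q.2 - q.1 ∈ K}.indicator (1 : Euc n × Euc n → ℝ≥0∞))
    simpa only [← covariogram_eq_lintegral hK.isCompact] using this
  even := fun x => by
    have e : x +ᵥ (K ∩ (-x +ᵥ K)) = K ∩ (x +ᵥ K) := by
      rw [vadd_set_inter, vadd_vadd, add_neg_cancel, zero_vadd, inter_comm]
    rw [covariogram, covariogram, ← e, measure_vadd]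
  logConcave := by
    have hc : Convex ℝ {q : Euc n × Euc n | q.2 ∈ K ∧ q.2 - q.1 ∈ K} := by
      rintro ⟨x, y⟩ ⟨h1, h2⟩ ⟨x', y'⟩ ⟨h1', h2'⟩ a b ha hb hab
      refine ⟨hK.convex h1 h1' ha hb hab, ?_⟩
      have := hK.convex h2 h2' ha hb hab
      convert! this using 1
      simp only [smul_sub, Prod.smul_mk, Prod.mk_add_mk]
      abel
    have := hc.logConcave_indicator.lintegral (prekopaLeindler_addHaar (volume : Measure (Euc n)))
      (measurable_one.indicator (measurableSet_covariogram hK.isCompact))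
    intro a b ha hb hab x y
    simp only [covariogram_eq_lintegral hK.isCompact]
    exact this a b ha hb hab x y
  bounded := ⟨volume K, hK.isCompact.measure_lt_top.ne, fun x => measure_mono inter_subset_left⟩
  support := by
    obtain ⟨R, hR⟩ := hK.isCompact.isBounded.exists_norm_le
    refine ⟨R + R, fun x hx => ?_⟩
    obtain ⟨y, hy, z, hz, hzy⟩ := nonempty_of_measure_ne_zero hx
    have : x = y - z := by rw [← hzy]; simp
    rw [this]
    exact (norm_sub_le _ _).trans (add_le_add (hR y hy) (hR z hz))
  pos := by
    obtain ⟨c, hc⟩ := hK.nonempty_interior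
    obtain ⟨ε, hε, hεK⟩ := Metric.isOpen_iff.1 isOpen_interior c hc
    -- If K contains the ball of radius ε about c and ‖x‖ < ε/2, the ball of radius ε/2 about c lies
    -- in both K and K + x.
    refine ⟨ε / 2, half_pos hε, volume (Metric.ball c (ε / 2)),
      (Metric.measure_ball_pos _ _ (half_pos hε)).ne', fun x hx => measure_mono fun y hy => ?_⟩
    rw [mem_ball_iff_norm] at hy
    constructor
    · exact interior_subset (hεK (by rw [mem_ball_iff_norm]; linarith))
    · rw [mem_vadd_set_iff_neg_vadd_mem]
      refine interior_subset (hεK ?_)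
      rw [mem_ball_iff_norm, vadd_eq_add]
      calc ‖-x + y - c‖ = ‖(y - c) - x‖ := by congr 1; abel
        _ ≤ ‖y - c‖ + ‖x‖ := norm_sub_le _ _
        _ < ε := by linarith

/-- A positively homogeneous, subadditive and definite function is a norm, so that its sublevel
sets are convex bodies. -/
theorem isConvexBody_sublevel {n : ℕ} {ν : Euc n → ℝ} (hadd : ∀ x y, ν (x + y) ≤ ν x + ν y)
    (hsmul : ∀ (c : ℝ) x, ν (c • x) = |c| * ν x) (hpos : ∀ x, x ≠ 0 → 0 < ν x) {c : ℝ}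
    (hc : 0 < c) : IsConvexBody {x | ν x ≤ c} := by
  have hconv : ConvexOn ℝ univ ν := by
    refine ⟨convex_univ, fun x _ y _ a b ha hb _ => (hadd _ _).trans_eq ?_⟩
    rw [hsmul, hsmul, abs_of_nonneg ha, abs_of_nonneg hb]
    rfl
  have hcont : Continuous ν := continuousOn_univ.1 (hconv.continuousOn isOpen_univ)
  have hν0 : ν 0 = 0 := by simpa using hsmul 0 0
  refine ⟨?_, ?_, ?_⟩
  · simpa using hconv.convex_le c
  · refine Metric.isCompact_of_isClosed_isBounded (isClosed_le hcont continuous_const) ?_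
    -- An empty sphere means the space is {0}. Otherwise the minimum of ν on the sphere bounds the
    -- sublevel set.
    rcases (Metric.sphere (0 : Euc n) 1).eq_empty_or_nonempty with h | h
    · have : ∀ x : Euc n, x = 0 := by
        intro x
        by_contra hx
        have : ‖x‖⁻¹ • x ∈ Metric.sphere (0 : Euc n) 1 := by
          simp [norm_smul, hx]
        rw [h] at this
        exact this
      exact Bornology.isBounded_singleton (x := (0 : Euc n)) |>.subset fun x _ => this x
    · obtain ⟨θ, hθ, hmin⟩ := (isCompact_sphere (0 : Euc n) 1).exists_isMinOn h hcont.continuousOn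
      have hθ0 : θ ≠ 0 := by
        rintro rfl
        simp at hθ
      have hm := hpos θ hθ0
      refine (Metric.isBounded_closedBall (x := (0 : Euc n)) (r := c / ν θ)).subset fun x hx => ?_
      rw [mem_closedBall_zero_iff, le_div_iff₀ hm]
      rcases eq_or_ne x 0 with rfl | hx0
      · simpa using hc.le
      · have h1 : ‖x‖⁻¹ • x ∈ Metric.sphere (0 : Euc n) 1 := by simp [norm_smul, hx0]
        have h2 : ν θ ≤ ν (‖x‖⁻¹ • x) := hmin h1
        rw [hsmul, abs_of_pos (by positivity), le_inv_mul_iff₀ (by positivity)] at h2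
        exact h2.trans hx
  · refine ⟨0, mem_interior.2 ⟨{x | ν x < c}, fun x (hx : ν x < c) => hx.le,
      isOpen_lt hcont continuous_const, ?_⟩⟩
    simpa [hν0] using hc

/-- Homogeneity of degree 1 identifies the star-shaped set with a sublevel set of the norm
`negMoment g p x ^ (-1 / p)`. -/
theorem mem_starSet_iff_negMoment {n : ℕ} {g : Euc n → ℝ≥0∞} (hg : IsLogConcaveBump g) {p : ℝ}
    (hp0 : 0 < p) (hp1 : p < 1) (C : ℝ≥0∞) (x : Euc n) :
    x ∈ starSet (fun θ => (C * negMoment g p θ) ^ (1 / p)) ↔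
      negMoment g p x ^ (-1 / p) ≤ C ^ (1 / p) := by
  have hp' : 0 < 1 / p := by positivity
  rcases eq_or_ne x 0 with rfl | hx
  · have h := hg.negMoment_smul_rpow hp0 0 (0 : Euc n)
    simp only [zero_smul, abs_zero, ENNReal.ofReal_zero, zero_mul] at h
    simp [h, starSet]
  have hx' : 0 < ‖x‖ := norm_pos_iff.2 hx
  set θ := ‖x‖⁻¹ • x with hθ
  have hxθ : x = ‖x‖ • θ := by rw [hθ, smul_smul, mul_inv_cancel₀ hx'.ne', one_smul]
  have hθ0 : θ ≠ 0 := smul_ne_zero (inv_ne_zero hx'.ne') hx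
  have hI0 := hg.negMoment_ne_zero hp0 θ
  have hI := hg.negMoment_ne_top hp0 hp1 hθ0
  have e : negMoment g p x ^ (-1 / p) = ENNReal.ofReal ‖x‖ * (negMoment g p θ ^ (1 / p))⁻¹ := by
    conv_lhs => rw [hxθ]
    rw [hg.negMoment_smul_rpow hp0, abs_of_pos hx', neg_div, ENNReal.rpow_neg]
  have hP0 : negMoment g p θ ^ (1 / p) ≠ 0 := by
    simp [ENNReal.rpow_eq_zero_iff, hI0, hI]
  have hP : negMoment g p θ ^ (1 / p) ≠ ∞ := ENNReal.rpow_ne_top_of_nonneg hp'.le hI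
  rw [e, ← div_eq_mul_inv, ENNReal.div_le_iff hP0 hP, ← ENNReal.mul_rpow_of_nonneg _ _ hp'.le]
  rfl

theorem isConvexBody_starSet_negMoment {n : ℕ} {g : Euc n → ℝ≥0∞} (hg : IsLogConcaveBump g)
    {p : ℝ} (hp0 : 0 < p) (hp1 : p < 1) {C : ℝ≥0∞} (hC0 : C ≠ 0) (hC : C ≠ ∞) :
    IsConvexBody (starSet fun θ => (C * negMoment g p θ) ^ (1 / p)) ∧
      -(starSet fun θ => (C * negMoment g p θ) ^ (1 / p)) =
        starSet fun θ => (C * negMoment g p θ) ^ (1 / p) := by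
  have hneg : -1 / p < 0 := div_neg_of_neg_of_pos (by norm_num) hp0
  have hfin : ∀ x : Euc n, negMoment g p x ^ (-1 / p) ≠ ∞ := fun x h => by
    rcases ENNReal.rpow_eq_top_iff.1 h with h | h
    · exact hg.negMoment_ne_zero hp0 x h.1
    · exact absurd h.2 (not_lt.2 hneg.le)
  have hc : C ^ (1 / p) ≠ ∞ := ENNReal.rpow_ne_top_of_nonneg (by positivity) hC
  have hc0 : C ^ (1 / p) ≠ 0 := by simp [ENNReal.rpow_eq_zero_iff, hC0, hC]
  have hset : (starSet fun θ => (C * negMoment g p θ) ^ (1 / p)) =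
      {x | (negMoment g p x ^ (-1 / p)).toReal ≤ (C ^ (1 / p)).toReal} := by
    ext x
    rw [mem_starSet_iff_negMoment hg hp0 hp1 C, mem_ofPred_eq,
      ENNReal.toReal_le_toReal (hfin x) hc]
  have hsmul : ∀ (c : ℝ) (x : Euc n), (negMoment g p (c • x) ^ (-1 / p)).toReal =
      |c| * (negMoment g p x ^ (-1 / p)).toReal := fun c x => by
    rw [hg.negMoment_smul_rpow hp0, ENNReal.toReal_mul, ENNReal.toReal_ofReal (abs_nonneg c)]
  rw [hset]
  constructor
  · refine isConvexBody_sublevel ?_ hsmul ?_ (ENNReal.toReal_pos hc0 hc)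
    · intro x y
      rw [← ENNReal.toReal_add (hfin x) (hfin y)]
      exact ENNReal.toReal_mono (ENNReal.add_ne_top.2 ⟨hfin x, hfin y⟩)
        (hg.negMoment_add_le hp0 hp1 x y)
    · intro x hx
      refine ENNReal.toReal_pos (fun h => ?_) (hfin x)
      rcases ENNReal.rpow_eq_zero_iff.1 h with h | h
      · exact absurd h.2 (not_lt.2 hneg.le)
      · exact hg.negMoment_ne_top hp0 hp1 hx h.1
  · ext x
    have := hsmul (-1) x
    rw [neg_one_smul] at this
    simp only [Set.mem_neg, mem_ofPred_eq, this]
    simp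

/-! ### The Fourier side -/

/-- The number 1/(it) has modulus 1/|t| and argument ±π/2; the cosine ignores the sign. -/
theorem Complex.re_one_div_I_mul_cpow {t p : ℝ} (ht : t ≠ 0) :
    ((1 / (I * t : ℂ)) ^ (p : ℂ)).re = |t| ^ (-p) * Real.cos (Real.pi * p / 2) := by
  have key : ∀ s : ℝ, 0 < s → ∀ z : ℂ, z ≠ 0 → ‖z‖ = s⁻¹ → |z.arg| = Real.pi / 2 →
      (z ^ (p : ℂ)).re = s ^ (-p) * Real.cos (Real.pi * p / 2) := by
    intro s hs z hz hzn hza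
    rw [Complex.cpow_ofReal_re, hzn, Real.rpow_neg hs.le, Real.inv_rpow hs.le]
    congr 1
    rw [← Real.cos_abs, abs_mul, hza, ← Real.cos_abs (Real.pi * p / 2), abs_div, abs_mul,
      abs_of_pos Real.pi_pos, abs_two]
    congr 1
    ring
  have ht' : (I * t : ℂ) ≠ 0 := mul_ne_zero I_ne_zero (by exact_mod_cast ht)
  refine key |t| (abs_pos.2 ht) _ (one_div_ne_zero ht') (by simp) ?_
  rw [one_div, abs_arg_inv]
  rcases lt_or_gt_of_ne ht with h | h
  · have : (I * t : ℂ) = ((-t : ℝ) : ℂ) * (-I) := by push_cast; ring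
    rw [this, arg_real_mul _ (neg_pos.2 h), arg_neg_I, abs_neg, abs_of_pos (by positivity)]
  · have : (I * t : ℂ) = ((t : ℝ) : ℂ) * I := by ring
    rw [this, arg_real_mul _ h, arg_I, abs_of_pos (by positivity)]

theorem integrableOn_rpow_mul_exp_neg {p ε : ℝ} (hp : 0 < p) (hε : 0 < ε) :
    IntegrableOn (fun r : ℝ => r ^ (p - 1) * Real.exp (-ε * r)) (Ioi 0) := by
  have := integrableOn_rpow_mul_exp_neg_mul_rpow (p := 1) (s := p - 1) (b := ε) (by linarith)
    zero_lt_one hε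
  simpa using this

/-- Both sides are analytic in the right half-plane and agree on the positive reals, by Euler's
integral. The identity theorem is used at the accumulation point 1. -/
theorem integral_rpow_mul_cexp_neg_mul {p : ℝ} (hp : 0 < p) {z : ℂ} (hz : 0 < z.re) :
    ∫ r in Ioi (0 : ℝ), ((r ^ (p - 1) : ℝ) : ℂ) * Complex.exp (-z * r) =
      (1 / z) ^ (p : ℂ) * Complex.Gamma p := by
  -- The integral is the complex moment generating function of r ↦ -r under r^(p-1) dr, whose
  -- analyticity is known.
  set μ : Measure ℝ := (volume.restrict (Ioi (0 : ℝ))).withDensity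
    fun r => ENNReal.ofReal (r ^ (p - 1)) with hμ
  have hdm : Measurable fun r : ℝ => ENNReal.ofReal (r ^ (p - 1)) := by fun_prop
  have hdt : ∀ᵐ r ∂volume.restrict (Ioi (0 : ℝ)), ENNReal.ofReal (r ^ (p - 1)) < ∞ :=
    Eventually.of_forall fun _ => ENNReal.ofReal_lt_top
  have hmgf : ∀ z : ℂ, ProbabilityTheory.complexMGF (fun r : ℝ => -r) μ z =
      ∫ r in Ioi (0 : ℝ), ((r ^ (p - 1) : ℝ) : ℂ) * Complex.exp (-z * r) := by
    intro z
    rw [ProbabilityTheory.complexMGF, hμ, integral_withDensity_eq_integral_toReal_smul hdm hdt]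
    refine setIntegral_congr_fun measurableSet_Ioi fun r hr => ?_
    have hr' : (0 : ℝ) < r := hr
    simp only [Complex.real_smul]
    rw [ENNReal.toReal_ofReal (by positivity)]
    push_cast
    ring_nf
  have hset : Ioi (0 : ℝ) ⊆ ProbabilityTheory.integrableExpSet (fun r : ℝ => -r) μ := by
    intro ε hε
    simp only [ProbabilityTheory.integrableExpSet, mem_ofPred_eq]
    rw [hμ, integrable_withDensity_iff_integrable_smul' hdm hdt]
    refine (integrableOn_rpow_mul_exp_neg hp hε).congr ?_
    filter_upwards [ae_restrict_mem measurableSet_Ioi] with r hr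
    have hr' : (0 : ℝ) < r := hr
    rw [ENNReal.toReal_ofReal (by positivity), smul_eq_mul]
    ring_nf
  have hint : Ioi (0 : ℝ) ⊆ interior (ProbabilityTheory.integrableExpSet (fun r : ℝ => -r) μ) :=
    interior_maximal hset isOpen_Ioi
  have hA : AnalyticOnNhd ℂ (ProbabilityTheory.complexMGF (fun r : ℝ => -r) μ) {z | 0 < z.re} :=
    ProbabilityTheory.analyticOnNhd_complexMGF.mono fun z hz => hint hz
  have hopen : IsOpen {z : ℂ | 0 < z.re} := isOpen_lt continuous_const Complex.continuous_re
  have hB : AnalyticOnNhd ℂ (fun z : ℂ => (1 / z) ^ (p : ℂ) * Complex.Gamma p) {z | 0 < z.re} := by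
    refine DifferentiableOn.analyticOnNhd (fun z hz => ?_) hopen
    have hz' : 0 < z.re := hz
    have hz0 : z ≠ 0 := by rintro rfl; simp at hz'
    have hsl : 1 / z ∈ Complex.slitPlane := by
      left
      rw [one_div, Complex.inv_re]
      exact div_pos hz' (Complex.normSq_pos.2 hz0)
    have h1 : DifferentiableAt ℂ (fun z : ℂ => 1 / z) z :=
      (differentiableAt_const _).div differentiableAt_id hz0
    exact ((h1.cpow_const hsl).mul_const _).differentiableWithinAt
  have hpre : IsPreconnected {z : ℂ | 0 < z.re} :=
    (convex_halfSpace_re_gt 0).isPreconnected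
  have hreal : ∀ ε : ℝ, 0 < ε → ProbabilityTheory.complexMGF (fun r : ℝ => -r) μ (ε : ℂ) =
      (1 / (ε : ℂ)) ^ (p : ℂ) * Complex.Gamma p := by
    intro ε hε
    rw [hmgf, ← Complex.integral_cpow_mul_exp_neg_mul_Ioi (a := (p : ℂ)) (by simpa using hp) hε]
    refine setIntegral_congr_fun measurableSet_Ioi fun r hr => ?_
    have hr' : (0 : ℝ) < r := hr
    rw [Complex.ofReal_cpow hr'.le]
    push_cast
    ring_nf
  have hfreq : ∃ᶠ z : ℂ in 𝓝[≠] 1, ProbabilityTheory.complexMGF (fun r : ℝ => -r) μ z =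
      (1 / z) ^ (p : ℂ) * Complex.Gamma p := by
    have ht : Tendsto (fun k : ℕ => ((1 + 1 / ((k : ℝ) + 1) : ℝ) : ℂ)) atTop (𝓝[≠] 1) := by
      refine tendsto_nhdsWithin_iff.2 ⟨?_, Eventually.of_forall fun k => ?_⟩
      · have h0 : Tendsto (fun k : ℕ => 1 + 1 / ((k : ℝ) + 1)) atTop (𝓝 (1 + 0)) :=
          tendsto_one_div_add_atTop_nhds_zero_nat.const_add 1
        have := (Complex.continuous_ofReal.tendsto _).comp h0
        simpa [Function.comp_def] using this
      · have : (0 : ℝ) < 1 / ((k : ℝ) + 1) := Nat.one_div_pos_of_nat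
        rw [mem_compl_iff, mem_singleton_iff, ← Complex.ofReal_one, Complex.ofReal_inj]
        linarith
    refine ht.frequently (Frequently.of_forall fun k => hreal _ ?_)
    have : (0 : ℝ) < 1 / ((k : ℝ) + 1) := Nat.one_div_pos_of_nat
    linarith
  rw [← hmgf]
  exact hA.eqOn_of_preconnected_of_frequently_eq hB hpre (by simp : (1 : ℂ) ∈ {z : ℂ | 0 < z.re})
    hfreq hz

theorem integral_cos_mul_rpow_mul_exp_neg {p ε : ℝ} (hp : 0 < p) (hε : 0 < ε) (t : ℝ) :
    ∫ r in Ioi (0 : ℝ), Real.cos (r * t) * (r ^ (p - 1) * Real.exp (-ε * r)) =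
      ((1 / (ε + Complex.I * t : ℂ)) ^ (p : ℂ)).re * Real.Gamma p := by
  have h := integral_rpow_mul_cexp_neg_mul hp (z := ε + Complex.I * t) (by simpa using hε)
  have hpt : ∀ r : ℝ, ((r ^ (p - 1) : ℝ) : ℂ) * Complex.exp (-(ε + Complex.I * t) * r) =
      ((r ^ (p - 1) * Real.exp (-ε * r) : ℝ) : ℂ) * Complex.exp ((-(r * t) : ℝ) * Complex.I) := by
    intro r
    push_cast
    rw [mul_assoc, ← Complex.exp_add]
    congr 2
    ring
  simp only [hpt] at h
  have hint : IntegrableOn (fun r : ℝ => ((r ^ (p - 1) * Real.exp (-ε * r) : ℝ) : ℂ) *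
      Complex.exp ((-(r * t) : ℝ) * Complex.I)) (Ioi 0) := by
    refine (integrableOn_rpow_mul_exp_neg hp hε).mono' ?_ ?_
    · exact Measurable.aestronglyMeasurable (by fun_prop)
    · filter_upwards [ae_restrict_mem measurableSet_Ioi] with r hr
      have hr' : (0 : ℝ) < r := hr
      rw [norm_mul, Complex.norm_exp_ofReal_mul_I, mul_one, Complex.norm_real,
        Real.norm_of_nonneg (by positivity)]
  have hre := congrArg Complex.re h
  rw [← Complex.reCLM_apply, ← Complex.reCLM.integral_comp_comm hint] at hre
  rw [Complex.Gamma_ofReal, Complex.re_mul_ofReal] at hre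
  rw [← hre]
  refine setIntegral_congr_fun measurableSet_Ioi fun r hr => ?_
  simp only [Complex.reCLM_apply]
  rw [Complex.re_ofReal_mul, Complex.exp_ofReal_mul_I_re, Real.cos_neg]
  ring

/-- The Mellin transform of a nonnegative characteristic function in terms of a negative moment. -/
theorem lintegral_charFun_mul_rpow {Ω : Type*} [MeasurableSpace Ω] {μ : Measure Ω}
    [IsFiniteMeasure μ] {T : Ω → ℝ} (hT : Measurable T) {p : ℝ} (hp0 : 0 < p) (hp1 : p < 1)
    (hpos : ∀ r : ℝ, 0 ≤ ∫ ω, Real.cos (r * T ω) ∂μ)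
    (hfin : ∫⁻ ω, ENNReal.ofReal |T ω| ^ (-p) ∂μ ≠ ∞) :
    ∫⁻ r in Ioi (0 : ℝ), ENNReal.ofReal ((∫ ω, Real.cos (r * T ω) ∂μ) * r ^ (p - 1)) =
      ENNReal.ofReal (Real.Gamma p * Real.cos (Real.pi * p / 2)) *
        ∫⁻ ω, ENNReal.ofReal |T ω| ^ (-p) ∂μ := by
  set P : ℝ → ℝ := fun r => ∫ ω, Real.cos (r * T ω) ∂μ with hP
  have hPm : Measurable P := by
    refine (StronglyMeasurable.integral_prod_right (f := fun (r : ℝ) ω => Real.cos (r * T ω))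
      ?_).measurable
    exact (Real.continuous_cos.measurable.comp (measurable_fst.mul
      (hT.comp measurable_snd))).stronglyMeasurable
  -- The factor exp(-ε_k r) makes the double integral absolutely convergent, so that Fubini applies;
  -- ε_k decreases to 0.
  set ε : ℕ → ℝ := fun k => 1 / ((k : ℝ) + 1) with hε
  have hε0 : ∀ k, 0 < ε k := fun k => Nat.one_div_pos_of_nat
  have hεanti : Antitone ε := fun k l hkl => Nat.one_div_le_one_div hkl
  have hεlim : Tendsto ε atTop (𝓝 0) := tendsto_one_div_add_atTop_nhds_zero_nat
  -- Since 0^(-p) = ∞, finiteness of the moment excludes zeros of T up to a null set.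
  have hT0 : ∀ᵐ ω ∂μ, T ω ≠ 0 := by
    filter_upwards [ae_lt_top ((ENNReal.measurable_ofReal.comp hT.abs).pow_const (-p)) hfin]
      with ω hω h0
    simp [h0, hp0] at hω
  have hTi : Integrable (fun ω => |T ω| ^ (-p)) μ := by
    refine ⟨(hT.abs.pow_const (-p)).aestronglyMeasurable, ?_⟩
    rw [hasFiniteIntegral_iff_ofReal (Eventually.of_forall fun ω => by positivity)]
    refine lt_of_le_of_ne le_top ?_
    rwa [lintegral_congr_ae (g := fun ω => ENNReal.ofReal |T ω| ^ (-p))]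
    filter_upwards [hT0] with ω hω
    rw [ENNReal.ofReal_rpow_of_pos (abs_pos.2 hω)]
  have hTe : ∫⁻ ω, ENNReal.ofReal |T ω| ^ (-p) ∂μ = ENNReal.ofReal (∫ ω, |T ω| ^ (-p) ∂μ) := by
    rw [ofReal_integral_eq_lintegral_ofReal hTi (Eventually.of_forall fun ω => by positivity)]
    refine lintegral_congr_ae ?_
    filter_upwards [hT0] with ω hω
    rw [ENNReal.ofReal_rpow_of_pos (abs_pos.2 hω)]
  have hGp : 0 < Real.Gamma p := Real.Gamma_pos_of_pos hp0
  have hcos : 0 < Real.cos (Real.pi * p / 2) := Real.cos_pos_of_mem_Ioo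
    ⟨by nlinarith [Real.pi_pos], by nlinarith [Real.pi_pos]⟩
  -- the regularised identity
  have hreg : ∀ k, ∫⁻ r in Ioi (0 : ℝ), ENNReal.ofReal (P r * (r ^ (p - 1) * Real.exp (-ε k * r))) =
      ENNReal.ofReal (∫ ω, ((1 / (ε k + Complex.I * T ω : ℂ)) ^ (p : ℂ)).re * Real.Gamma p ∂μ) := by
    intro k
    have hw := integrableOn_rpow_mul_exp_neg hp0 (hε0 k)
    have hprod : Integrable (fun q : ℝ × Ω => Real.cos (q.1 * T q.2) *
        (q.1 ^ (p - 1) * Real.exp (-ε k * q.1))) ((volume.restrict (Ioi 0)).prod μ) := by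
      have h1 := hw.mul_prod (integrable_const (μ := μ) (1 : ℝ))
      refine h1.mono ?_ (Eventually.of_forall fun q => ?_)
      · refine Measurable.aestronglyMeasurable ?_
        exact (Real.continuous_cos.measurable.comp (measurable_fst.mul
          (hT.comp measurable_snd))).mul (by fun_prop)
      · rw [norm_mul, norm_mul _ (1 : ℝ), mul_comm, norm_one]
        gcongr
        exact Real.abs_cos_le_one _
    have hsw := integral_integral_swap (f := fun r ω => Real.cos (r * T ω) *
        (r ^ (p - 1) * Real.exp (-ε k * r))) hprod
    simp only [integral_cos_mul_rpow_mul_exp_neg hp0 (hε0 k), integral_mul_const] at hsw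
    rw [integral_mul_const, ← hsw, ofReal_integral_eq_lintegral_ofReal]
    · have := hprod.integral_prod_left
      simpa only [integral_mul_const] using this
    · filter_upwards [ae_restrict_mem measurableSet_Ioi] with r hr
      have hr' : (0 : ℝ) < r := hr
      exact mul_nonneg (hpos r) (by positivity)
  -- the limit on the left
  have hlim1 : Tendsto (fun k => ∫⁻ r in Ioi (0 : ℝ),
      ENNReal.ofReal (P r * (r ^ (p - 1) * Real.exp (-ε k * r)))) atTop
      (𝓝 (∫⁻ r in Ioi (0 : ℝ), ENNReal.ofReal (P r * r ^ (p - 1)))) := by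
    -- Since P ≥ 0, the integrands increase with k; no integrability of P r^(p-1) is needed
    -- beforehand.
    refine lintegral_tendsto_of_tendsto_of_monotone (fun k => ?_) ?_ ?_
    · exact (ENNReal.measurable_ofReal.comp (hPm.mul (by fun_prop))).aemeasurable
    · filter_upwards [ae_restrict_mem measurableSet_Ioi] with r hr k l hkl
      have hr' : (0 : ℝ) < r := hr
      have := hpos r
      have h1 : -ε k * r ≤ -ε l * r := by nlinarith [hεanti hkl]
      dsimp only
      gcongr
    · refine Eventually.of_forall fun r => ?_
      refine (ENNReal.continuous_ofReal.tendsto _).comp (tendsto_const_nhds.mul ?_)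
      have h1 : Tendsto (fun k => Real.exp (-ε k * r)) atTop (𝓝 1) := by
        have := (Real.continuous_exp.tendsto _).comp (hεlim.neg.mul_const r)
        simpa [Function.comp_def] using this
      simpa using h1.const_mul (r ^ (p - 1))
  -- the limit on the right
  have hlim2 : Tendsto (fun k => ∫ ω, ((1 / (ε k + Complex.I * T ω : ℂ)) ^ (p : ℂ)).re *
      Real.Gamma p ∂μ) atTop
      (𝓝 (∫ ω, |T ω| ^ (-p) * Real.cos (Real.pi * p / 2) * Real.Gamma p ∂μ)) := by
    -- The dominating function comes from |ε + iT| ≥ |T|.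
    refine tendsto_integral_of_dominated_convergence (fun ω => |T ω| ^ (-p) * Real.Gamma p)
      (fun k => ?_) (hTi.mul_const _) (fun k => ?_) ?_
    · refine Measurable.aestronglyMeasurable ?_
      fun_prop
    · filter_upwards [hT0] with ω hω
      rw [norm_mul, Real.norm_of_nonneg hGp.le]
      gcongr
      refine (Complex.abs_re_le_norm _).trans ?_
      have hne : (1 / (ε k + Complex.I * T ω : ℂ)) ≠ 0 := by
        refine one_div_ne_zero fun h => ?_
        have := congrArg Complex.re h
        simp [(hε0 k).ne'] at this
      rw [Complex.norm_cpow_real, norm_div, norm_one, one_div, Real.inv_rpow (norm_nonneg _),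
        Real.rpow_neg (abs_nonneg _)]
      have hTω := abs_pos.2 hω
      gcongr
      have := Complex.abs_im_le_norm (ε k + Complex.I * T ω : ℂ)
      simpa using this
    · filter_upwards [hT0] with ω hω
      refine Tendsto.mul_const _ ?_
      rw [← Complex.re_one_div_I_mul_cpow hω]
      refine (Complex.continuous_re.tendsto _).comp ?_
      have hne : (Complex.I * T ω : ℂ) ≠ 0 :=
        mul_ne_zero Complex.I_ne_zero (by exact_mod_cast hω)
      have hslit : 1 / (Complex.I * T ω : ℂ) ∈ Complex.slitPlane := by
        right
        simp [hω]
      refine Tendsto.cpow ?_ tendsto_const_nhds hslit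
      refine Tendsto.div tendsto_const_nhds ?_ hne
      have : Tendsto (fun k => ((ε k : ℝ) : ℂ)) atTop (𝓝 0) := by
        have := (Complex.continuous_ofReal.tendsto 0).comp hεlim
        simpa [Function.comp_def] using this
      simpa using this.add_const (Complex.I * T ω : ℂ)
  have := tendsto_nhds_unique (hlim1.congr hreg) ((ENNReal.continuous_ofReal.tendsto _).comp hlim2)
  rw [this, hTe, ← ENNReal.ofReal_mul (by positivity), integral_mul_const, integral_mul_const]
  congr 1
  ring

/-- The squared modulus is (∫ cos)² + (∫ sin)²; written as double integrals over K × K, the addition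
formula combines them. -/
theorem sq_norm_fourierHat_charFn {n : ℕ} {K : Set (Euc n)} (hK : IsCompact K) (y : Euc n) :
    ‖fourierHat (charFn K) y‖ ^ 2 =
      ∫ q, Real.cos ⟪q.1 - q.2, y⟫ ∂((volume.restrict K).prod (volume.restrict K)) := by
  have : IsFiniteMeasure (volume.restrict K) := ⟨by
    rw [Measure.restrict_apply_univ]; exact hK.measure_lt_top⟩
  set μ := (volume.restrict K)
  have hc : Integrable (fun x : Euc n => Real.cos ⟪x, y⟫) μ :=
    Integrable.of_bound (C := 1) (Continuous.aestronglyMeasurable (by fun_prop))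
      (Eventually.of_forall fun x => Real.abs_cos_le_one _)
  have hs : Integrable (fun x : Euc n => Real.sin ⟪x, y⟫) μ :=
    Integrable.of_bound (C := 1) (Continuous.aestronglyMeasurable (by fun_prop))
      (Eventually.of_forall fun x => Real.abs_sin_le_one _)
  have e1 : fourierHat (charFn K) y = ∫ x, Complex.exp (((-⟪x, y⟫ : ℝ) : ℂ) * Complex.I) ∂μ := by
    rw [fourierHat, ← integral_indicator hK.measurableSet]
    congr 1
    ext x
    by_cases hx : x ∈ K
    · simp [charFn, hx]
      congr 2
      ring
    · simp [charFn, hx]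
  have hexp : Integrable (fun x : Euc n => Complex.exp (((-⟪x, y⟫ : ℝ) : ℂ) * Complex.I)) μ :=
    Integrable.of_bound (C := 1) (Continuous.aestronglyMeasurable (by fun_prop))
      (Eventually.of_forall fun x => (Complex.norm_exp_ofReal_mul_I _).le)
  have ere : (fourierHat (charFn K) y).re = ∫ x, Real.cos ⟪x, y⟫ ∂μ := by
    rw [e1, ← Complex.reCLM_apply, ← Complex.reCLM.integral_comp_comm hexp]
    simp only [Complex.reCLM_apply, Complex.exp_ofReal_mul_I_re, Real.cos_neg]
  have eim : (fourierHat (charFn K) y).im = -∫ x, Real.sin ⟪x, y⟫ ∂μ := by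
    rw [e1, ← Complex.imCLM_apply, ← Complex.imCLM.integral_comp_comm hexp]
    simp only [Complex.imCLM_apply, Complex.exp_ofReal_mul_I_im, Real.sin_neg, integral_neg]
  rw [← Complex.normSq_eq_norm_sq, Complex.normSq_apply, ere, eim, neg_mul_neg,
    ← integral_prod_mul, ← integral_prod_mul, ← integral_add (hc.mul_prod hc) (hs.mul_prod hs)]
  refine integral_congr_ae (Eventually.of_forall fun q => ?_)
  simp only [inner_sub_left, Real.cos_sub]

/-- The covariogram is the density of the difference of two points of K, by Tonelli and the
substitution z = y - x. -/
theorem lintegral_mul_covariogram {n : ℕ} {K : Set (Euc n)} (hK : IsCompact K)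
    {φ : Euc n → ℝ≥0∞} (hφ : Measurable φ) :
    ∫⁻ x, φ x * covariogram K x =
      ∫⁻ q, φ (q.1 - q.2) ∂((volume.restrict K).prod (volume.restrict K)) := by
  have hms := measurableSet_covariogram hK
  have hm1 : Measurable (K.indicator (1 : Euc n → ℝ≥0∞)) :=
    measurable_one.indicator hK.measurableSet
  have e : ∀ x y : Euc n, {q : Euc n × Euc n | q.2 ∈ K ∧ q.2 - q.1 ∈ K}.indicator
      (1 : Euc n × Euc n → ℝ≥0∞) (x, y) = K.indicator 1 y * K.indicator 1 (y - x) := by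
    intro x y
    by_cases h1 : y ∈ K <;> by_cases h2 : y - x ∈ K <;> simp [h1, h2]
  have hm2 : ∀ x, Measurable fun y : Euc n =>
      K.indicator (1 : Euc n → ℝ≥0∞) y * K.indicator 1 (y - x) := fun x =>
    hm1.mul (hm1.comp (measurable_id.sub_const x))
  simp only [covariogram_eq_lintegral hK, e]
  rw [lintegral_prod (fun q : Euc n × Euc n => φ (q.1 - q.2))
    (hφ.comp (measurable_fst.sub measurable_snd)).aemeasurable]
  calc ∫⁻ x, φ x * ∫⁻ y, K.indicator (1 : Euc n → ℝ≥0∞) y * K.indicator 1 (y - x)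
      = ∫⁻ x, ∫⁻ y, φ x * (K.indicator (1 : Euc n → ℝ≥0∞) y * K.indicator 1 (y - x)) := by
        refine lintegral_congr fun x => ?_
        rw [lintegral_const_mul _ (hm2 x)]
    _ = ∫⁻ y, ∫⁻ x, φ x * (K.indicator (1 : Euc n → ℝ≥0∞) y * K.indicator 1 (y - x)) := by
        refine lintegral_lintegral_swap (Measurable.aemeasurable ?_)
        exact (hφ.comp measurable_fst).mul ((hm1.comp measurable_snd).mul
          (hm1.comp (measurable_snd.sub measurable_fst)))
    _ = ∫⁻ y, ∫⁻ z, φ (y - z) * (K.indicator (1 : Euc n → ℝ≥0∞) y * K.indicator 1 z) := by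
        refine lintegral_congr fun y => ?_
        rw [← lintegral_sub_left_eq_self _ y]
        simp
    _ = _ := by
        rw [← lintegral_indicator hK.measurableSet]
        refine lintegral_congr fun y => ?_
        by_cases hy : y ∈ K
        · simp only [indicator_of_mem hy, Pi.one_apply, one_mul]
          rw [← lintegral_indicator hK.measurableSet]
          refine lintegral_congr fun z => ?_
          by_cases hz : z ∈ K <;> simp [hz]
        · simp [hy]

/-- The radial integral of the power spectrum of a convex body as a negative moment of its
covariogram. -/
theorem lintegral_sq_norm_fourierHat {n : ℕ} {K : Set (Euc n)} (hK : IsConvexBody K) {p : ℝ}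
    (hp0 : 0 < p) (hp1 : p < 1) {θ : Euc n} (hθ : θ ≠ 0) :
    ∫⁻ r in Ioi (0 : ℝ), ENNReal.ofReal (‖fourierHat (charFn K) (r • θ)‖ ^ 2 * r ^ (p - 1)) =
      ENNReal.ofReal (Real.Gamma p * Real.cos (Real.pi * p / 2)) *
        negMoment (covariogram K) p θ := by
  have : IsFiniteMeasure (volume.restrict K) := ⟨by
    rw [Measure.restrict_apply_univ]; exact hK.isCompact.measure_lt_top⟩
  have hm : Measurable fun x : Euc n => ENNReal.ofReal |⟪θ, x⟫| ^ (-p) :=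
    (measurable_ofReal_abs_rpow (-p)).comp (by fun_prop : Measurable fun x => ⟪θ, x⟫)
  have hneg : negMoment (covariogram K) p θ = ∫⁻ q, ENNReal.ofReal |⟪θ, q.1 - q.2⟫| ^ (-p)
      ∂((volume.restrict K).prod (volume.restrict K)) :=
    lintegral_mul_covariogram hK.isCompact hm
  have hcos : ∀ r : ℝ, ‖fourierHat (charFn K) (r • θ)‖ ^ 2 =
      ∫ q, Real.cos (r * ⟪θ, q.1 - q.2⟫) ∂((volume.restrict K).prod (volume.restrict K)) := by
    intro r
    rw [sq_norm_fourierHat_charFn hK.isCompact]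
    simp only [inner_smul_right, real_inner_comm]
  simp only [hcos]
  rw [hneg]
  refine lintegral_charFun_mul_rpow (T := fun q : Euc n × Euc n => ⟪θ, q.1 - q.2⟫)
    (by fun_prop) hp0 hp1 (fun r => ?_) ?_
  · rw [← hcos]; positivity
  · rw [← hneg]
    exact (isLogConcaveBump_covariogram hK).negMoment_ne_top hp0 hp1 hθ

/-! ### Polar coordinates -/

/-- Integration in polar coordinates. -/
theorem lintegral_eq_lintegral_toSphere {n : ℕ} (hn : 1 ≤ n) {f : Euc n → ℝ≥0∞}
    (hf : Measurable f) :
    ∫⁻ x, f x = ∫⁻ θ : Metric.sphere (0 : Euc n) 1, (∫⁻ r in Ioi (0 : ℝ),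
      ENNReal.ofReal (r ^ ((n : ℝ) - 1)) * f (r • (θ : Euc n)))
      ∂(volume : Measure (Euc n)).toSphere := by
  have : Nontrivial (Euc n) := by
    have : Nonempty (Fin n) := ⟨⟨0, hn⟩⟩
    infer_instance
  have hd : Module.finrank ℝ (Euc n) = n := by simp
  have hmp := (volume : Measure (Euc n)).measurePreserving_homeomorphUnitSphereProd
  rw [hd] at hmp
  have hm : Measurable fun q : Metric.sphere (0 : Euc n) 1 × Ioi (0 : ℝ) =>
      f ((q.2 : ℝ) • (q.1 : Euc n)) := hf.comp (by fun_prop)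
  calc ∫⁻ x, f x = ∫⁻ x : ({(0)}ᶜ : Set (Euc n)), f x ∂((volume : Measure (Euc n)).comap (↑)) := by
        rw [lintegral_subtype_comap (measurableSet_singleton _).compl f,
          restrict_compl_singleton]
    _ = ∫⁻ q, f ((q.2 : ℝ) • (q.1 : Euc n))
          ∂((volume : Measure (Euc n)).toSphere.prod (Measure.volumeIoiPow (n - 1))) := by
        rw [← hmp.lintegral_comp hm]
        refine lintegral_congr fun x => ?_
        have hx : ‖(x : Euc n)‖ ≠ 0 := norm_ne_zero_iff.2 x.2
        simp [smul_smul, hx]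
    _ = ∫⁻ θ : Metric.sphere (0 : Euc n) 1, ∫⁻ r : Ioi (0 : ℝ), f ((r : ℝ) • (θ : Euc n))
          ∂(Measure.volumeIoiPow (n - 1)) ∂(volume : Measure (Euc n)).toSphere :=
        lintegral_prod _ hm.aemeasurable
    _ = _ := by
        refine lintegral_congr fun θ => ?_
        have hmθ : Measurable fun r : Ioi (0 : ℝ) => f ((r : ℝ) • (θ : Euc n)) :=
          hf.comp (by fun_prop)
        rw [Measure.volumeIoiPow, lintegral_withDensity_eq_lintegral_mul _ (by fun_prop) hmθ]
        simp only [Pi.mul_apply]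
        rw [lintegral_subtype_comap measurableSet_Ioi
          fun r : ℝ => ENNReal.ofReal (r ^ (n - 1)) * f (r • (θ : Euc n))]
        refine setLIntegral_congr_fun measurableSet_Ioi fun r hr => ?_
        rw [← Real.rpow_natCast, Nat.cast_sub hn, Nat.cast_one]

theorem lintegral_rpow_sub_one {s : ℝ} (hs : 0 < s) {T : ℝ} (hT : 0 ≤ T) :
    ∫⁻ r in Ioc 0 T, ENNReal.ofReal (r ^ (s - 1)) = ENNReal.ofReal (T ^ s / s) := by
  have hi : IntervalIntegrable (fun r : ℝ => r ^ (s - 1)) volume 0 T :=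
    intervalIntegral.intervalIntegrable_rpow' (by linarith)
  rw [← ofReal_integral_eq_lintegral_ofReal hi.1, ← intervalIntegral.integral_of_le hT,
    integral_rpow (Or.inl (by linarith))]
  · simp [hs.ne']
  · filter_upwards [ae_restrict_mem measurableSet_Ioc] with r hr
    exact Real.rpow_nonneg hr.1.le _

theorem lintegral_Ioi_indicator_rpow {s : ℝ} (hs : 0 < s) {ρ : ℝ≥0∞} (hρ : ρ ≠ ∞) :
    ∫⁻ r in Ioi (0 : ℝ), {r : ℝ | ENNReal.ofReal r ≤ ρ}.indicator
      (fun r => ENNReal.ofReal (r ^ (s - 1))) r = ρ ^ s / ENNReal.ofReal s := by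
  have hms : MeasurableSet {r : ℝ | ENNReal.ofReal r ≤ ρ} :=
    measurableSet_le ENNReal.measurable_ofReal measurable_const
  have hset : {r : ℝ | ENNReal.ofReal r ≤ ρ} ∩ Ioi 0 = Ioc 0 ρ.toReal := by
    ext r
    simp only [mem_inter_iff, mem_ofPred_eq, mem_Ioi, mem_Ioc, and_comm,
      ENNReal.ofReal_le_iff_le_toReal hρ]
  rw [lintegral_indicator hms, Measure.restrict_restrict hms, hset,
    lintegral_rpow_sub_one hs ENNReal.toReal_nonneg, ENNReal.ofReal_div_of_pos hs,
    ← ENNReal.ofReal_rpow_of_nonneg ENNReal.toReal_nonneg hs.le, ENNReal.ofReal_toReal hρ]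

theorem measurableSet_starSet {n : ℕ} {ρ : Euc n → ℝ≥0∞} (hρ : Measurable ρ) :
    MeasurableSet (starSet ρ) :=
  measurableSet_le (by fun_prop) (hρ.comp (by fun_prop))

theorem starSet_congr {n : ℕ} {ρ ρ' : Euc n → ℝ≥0∞} (h : ∀ θ, ‖θ‖ = 1 → ρ θ = ρ' θ) :
    starSet ρ = starSet ρ' := by
  ext x
  rcases eq_or_ne x 0 with rfl | hx
  · simp [starSet]
  · simp only [starSet, mem_ofPred_eq]
    rw [h _ (by rw [norm_smul, norm_inv, norm_norm, inv_mul_cancel₀ (norm_ne_zero_iff.2 hx)])]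

theorem smul_starSet {n : ℕ} {c : ℝ} (hc : 0 < c) (ρ : Euc n → ℝ≥0∞) :
    c • starSet ρ = starSet fun θ => ENNReal.ofReal c * ρ θ := by
  ext x
  rw [mem_smul_set_iff_inv_smul_mem₀ hc.ne']
  simp only [starSet, mem_ofPred_eq]
  have e : ‖c⁻¹ • x‖⁻¹ • c⁻¹ • x = ‖x‖⁻¹ • x := by
    rw [norm_smul, smul_smul, norm_inv, Real.norm_of_nonneg hc.le, mul_inv, inv_inv,
      mul_assoc, mul_comm, mul_assoc, inv_mul_cancel₀ hc.ne', mul_one]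
  rw [e, norm_smul, norm_inv, Real.norm_of_nonneg hc.le, ENNReal.ofReal_mul (by positivity),
    ENNReal.ofReal_inv_of_pos hc, mul_comm, ← div_eq_mul_inv,
    ENNReal.div_le_iff' (by simpa using hc) ENNReal.ofReal_ne_top]

/-- The power of the product splits even for b = 0, because r is positive and finite. -/
theorem ofReal_rpow_mul_ofReal_abs_mul_rpow {a b r p : ℝ} (hr : 0 < r) :
    ENNReal.ofReal (r ^ (a - 1)) * ENNReal.ofReal |r * b| ^ (-p) =
      ENNReal.ofReal |b| ^ (-p) * ENNReal.ofReal (r ^ (a - p - 1)) := by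
  have h0 : ENNReal.ofReal r ^ (-p) = ENNReal.ofReal (r ^ (-p)) :=
    ENNReal.ofReal_rpow_of_pos hr
  rw [abs_mul, abs_of_pos hr, ENNReal.ofReal_mul hr.le]
  have h1 : (ENNReal.ofReal r * ENNReal.ofReal |b|) ^ (-p) =
      ENNReal.ofReal r ^ (-p) * ENNReal.ofReal |b| ^ (-p) := by
    rw [ENNReal.rpow_neg, ENNReal.rpow_neg, ENNReal.rpow_neg]
    rcases le_total 0 p with hp | hp
    · rw [ENNReal.mul_rpow_of_nonneg _ _ hp, ENNReal.mul_inv]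
      · left; simp [ENNReal.rpow_eq_zero_iff, hr]
      · left; simp [ENNReal.rpow_eq_top_iff, hr]
    · rw [ENNReal.mul_rpow_of_ne_top ENNReal.ofReal_ne_top ENNReal.ofReal_ne_top, ENNReal.mul_inv]
      · left; simp [ENNReal.rpow_eq_zero_iff, hr]
      · left; simp [ENNReal.rpow_eq_top_iff, hr]
  rw [h1, h0, ← mul_assoc, ← ENNReal.ofReal_mul (by positivity), ← Real.rpow_add hr, mul_comm]
  ring_nf

theorem setLIntegral_starSet_abs_inner {n : ℕ} (hn : 1 ≤ n) {ρ : Euc n → ℝ≥0∞}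
    (hρ : Measurable ρ) (hρt : ∀ θ, ‖θ‖ = 1 → ρ θ ≠ ∞) {p : ℝ} (hp : p < n) (u : Euc n) :
    ∫⁻ x in starSet ρ, ENNReal.ofReal |⟪x, u⟫| ^ (-p) =
      ∫⁻ θ : Metric.sphere (0 : Euc n) 1, ENNReal.ofReal |⟪(θ : Euc n), u⟫| ^ (-p) *
        (ρ θ ^ (n - p) / ENNReal.ofReal (n - p)) ∂(volume : Measure (Euc n)).toSphere := by
  have hm : Measurable fun x : Euc n => ENNReal.ofReal |⟪x, u⟫| ^ (-p) :=
    (measurable_ofReal_abs_rpow (-p)).comp (by fun_prop : Measurable fun x => ⟪x, u⟫)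
  rw [← lintegral_indicator (measurableSet_starSet hρ),
    lintegral_eq_lintegral_toSphere hn (hm.indicator (measurableSet_starSet hρ))]
  refine lintegral_congr fun θ => ?_
  have hθ : ‖(θ : Euc n)‖ = 1 := norm_eq_of_mem_sphere θ
  have hms : MeasurableSet {r : ℝ | ENNReal.ofReal r ≤ ρ θ} :=
    measurableSet_le ENNReal.measurable_ofReal measurable_const
  rw [← lintegral_Ioi_indicator_rpow (sub_pos.2 hp) (hρt θ hθ), ← lintegral_const_mul _
    (Measurable.indicator (by fun_prop) hms)]
  refine setLIntegral_congr_fun measurableSet_Ioi fun r hr => ?_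
  have hr' : (0 : ℝ) < r := hr
  have hmem : r • (θ : Euc n) ∈ starSet ρ ↔ r ∈ {r : ℝ | ENNReal.ofReal r ≤ ρ θ} := by
    simp only [starSet, mem_ofPred_eq]
    rw [norm_smul, hθ, mul_one, Real.norm_of_nonneg hr'.le, smul_smul, inv_mul_cancel₀ hr'.ne',
      one_smul]
  by_cases h : r • (θ : Euc n) ∈ starSet ρ
  · simp only [indicator_of_mem h, indicator_of_mem (hmem.1 h)]
    rw [real_inner_smul_left, ofReal_rpow_mul_ofReal_abs_mul_rpow hr']
  · simp only [indicator_of_notMem h, indicator_of_notMem (fun h' => h (hmem.2 h')), mul_zero]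

theorem negMoment_eq_lintegral_toSphere {n : ℕ} (hn : 1 ≤ n) {g : Euc n → ℝ≥0∞}
    (hg : Measurable g) (p : ℝ) (u : Euc n) :
    negMoment g p u = ∫⁻ θ : Metric.sphere (0 : Euc n) 1,
      ENNReal.ofReal |⟪(θ : Euc n), u⟫| ^ (-p) *
        (∫⁻ r in Ioi (0 : ℝ), g (r • (θ : Euc n)) * ENNReal.ofReal (r ^ (n - p - 1)))
        ∂(volume : Measure (Euc n)).toSphere := by
  have hm : Measurable fun x : Euc n => ENNReal.ofReal |⟪u, x⟫| ^ (-p) * g x :=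
    ((measurable_ofReal_abs_rpow (-p)).comp (by fun_prop : Measurable fun x => ⟪u, x⟫)).mul hg
  rw [negMoment, lintegral_eq_lintegral_toSphere hn hm]
  refine lintegral_congr fun θ => ?_
  have hgθ : Measurable fun r : ℝ => g (r • (θ : Euc n)) := hg.comp (by fun_prop)
  have hm' : Measurable fun r : ℝ =>
      g (r • (θ : Euc n)) * ENNReal.ofReal (r ^ (n - p - 1)) :=
    hgθ.mul (by fun_prop)
  rw [← lintegral_const_mul _ hm']
  refine setLIntegral_congr_fun measurableSet_Ioi fun r hr => ?_
  rw [real_inner_smul_right, ← mul_assoc, ofReal_rpow_mul_ofReal_abs_mul_rpow hr,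
    real_inner_comm, mul_assoc, mul_comm (g _)]

/-! ### Radial mean bodies -/

section RadialMeanBody

variable {n : ℕ} {K : Set (Euc n)}

theorem IsConvexBody.volume_ne_zero (hK : IsConvexBody K) : volume K ≠ 0 :=
  fun h => (isOpen_interior.measure_pos volume hK.nonempty_interior).ne'
    (measure_mono_null interior_subset h)

theorem IsConvexBody.volume_ne_top (hK : IsConvexBody K) : volume K ≠ ∞ :=
  hK.isCompact.measure_lt_top.ne

theorem measurable_radialMeanRadial (hK : IsConvexBody K) (s : ℝ) :
    Measurable (radialMeanRadial s K) := by
  have hg := (isLogConcaveBump_covariogram hK).measurable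
  have hm : Measurable fun q : Euc n × ℝ =>
      covariogram K (q.2 • q.1) / volume K * ENNReal.ofReal (q.2 ^ (s - 1)) :=
    ((hg.comp (by fun_prop)).div_const _).mul (by fun_prop)
  exact ((hm.lintegral_prod_right' (ν := volume.restrict (Ioi (0 : ℝ)))).const_mul _).pow_const _

/-- The ratio g_K/Vol(K) is at most 1 and vanishes beyond some radius R, and s ∫₀^R r^(s-1) dr =
R^s. -/
theorem radialMeanRadial_le (hK : IsConvexBody K) {s : ℝ} (hs : 0 < s) :
    ∃ R : ℝ, ∀ θ : Euc n, ‖θ‖ = 1 → radialMeanRadial s K θ ≤ ENNReal.ofReal R := by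
  obtain ⟨R, hR⟩ := (isLogConcaveBump_covariogram hK).support
  refine ⟨max R 0, fun θ hθ => ?_⟩
  have hle : ∫⁻ r in Ioi (0 : ℝ), covariogram K (r • θ) / volume K * ENNReal.ofReal (r ^ (s - 1)) ≤
      ENNReal.ofReal (max R 0 ^ s / s) := by
    rw [← lintegral_rpow_sub_one hs (le_max_right R 0), ← lintegral_indicator measurableSet_Ioi,
      ← lintegral_indicator measurableSet_Ioc]
    refine lintegral_mono fun r => ?_
    by_cases hr : r ∈ Ioi (0 : ℝ)
    · have hr' : (0 : ℝ) < r := hr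
      rw [indicator_of_mem hr]
      by_cases h0 : covariogram K (r • θ) = 0
      · simp [h0]
      · have := hR _ h0
        rw [norm_smul, hθ, mul_one, Real.norm_of_nonneg hr'.le] at this
        rw [indicator_of_mem (show r ∈ Ioc 0 (max R 0) from ⟨hr', this.trans (le_max_left _ _)⟩)]
        refine mul_le_of_le_one_left' ?_
        refine ENNReal.div_le_of_le_mul ?_
        rw [one_mul]
        exact measure_mono inter_subset_left
    · simp [indicator_of_notMem hr]
  rw [radialMeanRadial, one_div, ENNReal.rpow_inv_le_iff hs]
  refine (mul_le_mul_right hle _).trans ?_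
  rw [ENNReal.ofReal_rpow_of_nonneg (le_max_right _ _) hs.le, ← ENNReal.ofReal_mul hs.le,
    mul_div_cancel₀ _ hs.ne']

theorem volume_radialMeanBody_ne_top (hK : IsConvexBody K) {s : ℝ} (hs : 0 < s) :
    volume (radialMeanBody s K) ≠ ∞ := by
  obtain ⟨R, hR⟩ := radialMeanRadial_le hK hs
  refine ((measure_mono ?_).trans_lt (measure_closedBall_lt_top (x := (0 : Euc n))
    (r := max R 0))).ne
  intro x hx
  rw [mem_closedBall_zero_iff]
  rcases eq_or_ne x 0 with rfl | hx0
  · simp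
  · have hle := le_trans (hx : ENNReal.ofReal ‖x‖ ≤ _) (hR _ (norm_smul_inv_norm (𝕜 := ℝ) hx0))
    have hpos : 0 < ‖x‖ := norm_pos_iff.2 hx0
    rcases le_total R 0 with h | h
    · rw [ENNReal.ofReal_of_nonpos h, nonpos_iff_eq_zero, ENNReal.ofReal_eq_zero] at hle
      linarith
    · exact ((ENNReal.ofReal_le_ofReal_iff h).1 hle).trans (le_max_left _ _)

/-- In polar coordinates the body contributes ρ^(n-p)/(n-p) in each direction, which by definition
of the radial mean body is the radial integral of g_K/Vol(K) against r^(n-p-1). -/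
theorem setLIntegral_radialMeanBody (hn : 1 ≤ n) (hK : IsConvexBody K) {p : ℝ} (hp : p < n)
    (u : Euc n) :
    ∫⁻ x in radialMeanBody (n + -p) K, ENNReal.ofReal |⟪x, u⟫| ^ (-p) =
      negMoment (covariogram K) p u / volume K := by
  have hs : 0 < (n : ℝ) - p := sub_pos.2 hp
  have hgm := (isLogConcaveBump_covariogram hK).measurable
  obtain ⟨R, hR⟩ := radialMeanRadial_le hK hs
  rw [← sub_eq_add_neg, radialMeanBody, setLIntegral_starSet_abs_inner hn
    (measurable_radialMeanRadial hK _)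
    (fun θ hθ => ((hR θ hθ).trans_lt ENNReal.ofReal_lt_top).ne) hp,
    negMoment_eq_lintegral_toSphere hn hgm, div_eq_mul_inv,
    ← lintegral_mul_const' _ _ (ENNReal.inv_ne_top.2 hK.volume_ne_zero)]
  refine lintegral_congr fun θ => ?_
  have hgθ : Measurable fun r : ℝ => covariogram K (r • (θ : Euc n)) := hgm.comp (by fun_prop)
  rw [mul_assoc, ← lintegral_mul_const' _ _ (ENNReal.inv_ne_top.2 hK.volume_ne_zero),
    radialMeanRadial, one_div, ENNReal.rpow_inv_rpow hs.ne', mul_comm (ENNReal.ofReal _),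
    ENNReal.mul_div_cancel_right (by simpa using hp) ENNReal.ofReal_ne_top]
  congr 1
  refine lintegral_congr fun r => ?_
  rw [div_eq_mul_inv, mul_right_comm]

theorem volume_radialMeanBody_ne_zero (hn : 1 ≤ n) (hK : IsConvexBody K) {p : ℝ} (hp0 : 0 < p)
    (hp : p < n) : volume (radialMeanBody (n + -p) K) ≠ 0 := by
  intro h
  -- Integration over a null set would give 0, but the moment on the other side never vanishes; the
  -- choice u = 0 is immaterial.
  have h1 := setLIntegral_radialMeanBody hn hK hp 0
  rw [setLIntegral_measure_zero _ _ h] at h1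
  exact ENNReal.div_ne_zero.2 ⟨(isLogConcaveBump_covariogram hK).negMoment_ne_zero hp0 0,
    hK.volume_ne_top⟩ h1.symm

end RadialMeanBody

/-! ### Both bodies as star-shaped sets of the same negative moment -/

theorem fourierMeanBody_eq {n : ℕ} {K : Set (Euc n)} (hK : IsConvexBody K) {p : ℝ} (hp0 : 0 < p)
    (hp1 : p < 1) :
    fourierMeanBody p K = starSet fun θ =>
      (ENNReal.ofReal (Real.Gamma (1 + p) * Real.cos (Real.pi * p / 2)) / volume K *
        negMoment (covariogram K) p θ) ^ (1 / p) := by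
  refine starSet_congr fun θ hθ => ?_
  have hθ0 : θ ≠ 0 := by rintro rfl; simp at hθ
  rw [fourierMeanRadial, lintegral_sq_norm_fourierHat hK hp0 hp1 hθ0, add_comm 1 p,
    Real.Gamma_add_one hp0.ne', mul_assoc p, ENNReal.ofReal_mul hp0.le]
  congr 1
  simp only [div_eq_mul_inv]
  ring

theorem smul_polarMeanZonoid {n : ℕ} (hn : 1 ≤ n) {K : Set (Euc n)} (hK : IsConvexBody K)
    {p : ℝ} (hp0 : 0 < p) (hp : p < n) {a : ℝ} (ha : 0 < a) :
    (a * volume.real K) ^ (1 / p) • polarMeanZonoid (-p) K = starSet fun θ =>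
      (ENNReal.ofReal a / volume K * negMoment (covariogram K) p θ) ^ (1 / p) := by
  set W := volume (radialMeanBody (n + -p) K) with hW
  have hs : 0 < (n : ℝ) + -p := by linarith
  have hW0 : W ≠ 0 := volume_radialMeanBody_ne_zero hn hK hp0 hp
  have hWt : W ≠ ∞ := volume_radialMeanBody_ne_top hK hs
  have hV0 := hK.volume_ne_zero
  have hVt := hK.volume_ne_top
  have hv : 0 < volume.real K := ENNReal.toReal_pos hV0 hVt
  have hw : 0 < volume.real (radialMeanBody (n + -p) K) := ENNReal.toReal_pos hW0 hWt
  have hp' : 0 ≤ 1 / p := by positivity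
  rw [polarMeanZonoid, polarCentroidBody, smul_starSet (by positivity),
    smul_starSet (by positivity)]
  congr 1
  ext θ
  set I := negMoment (covariogram K) p θ
  -- The negative exponent inverts the volume ratio, so that Vol(R_{n-p}K) cancels against the
  -- normalisation of the centroid body.
  have e1 : (volume.real K / volume.real (radialMeanBody (n + -p) K)) ^ (1 / -p) =
      (volume.real (radialMeanBody (n + -p) K) / volume.real K) ^ (1 / p) := by
    rw [one_div_neg_eq_neg_one_div, Real.rpow_neg (by positivity),
      ← Real.inv_rpow (by positivity), inv_div]
  rw [polarCentroidRadial, setLIntegral_radialMeanBody hn hK hp, neg_div_neg_eq, e1,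
    ← ENNReal.ofReal_rpow_of_nonneg (by positivity) hp',
    ← ENNReal.ofReal_rpow_of_nonneg (by positivity) hp', ← ENNReal.mul_rpow_of_nonneg _ _ hp',
    ← ENNReal.mul_rpow_of_nonneg _ _ hp']
  congr 1
  rw [ENNReal.ofReal_mul ha.le, ENNReal.ofReal_div_of_pos hv, ofReal_measureReal hVt,
    ofReal_measureReal hWt, ← hW]
  calc ENNReal.ofReal a * volume K * (W / volume K * (W⁻¹ * (I / volume K)))
      = (volume K * (volume K)⁻¹) * (W * W⁻¹) * (ENNReal.ofReal a * (volume K)⁻¹ * I) := by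
        simp only [div_eq_mul_inv]
        ring
    _ = ENNReal.ofReal a / volume K * I := by
        rw [ENNReal.mul_inv_cancel hV0 hVt, ENNReal.mul_inv_cancel hW0 hWt, one_mul, one_mul,
          div_eq_mul_inv]

theorem lemmal (n : ℕ) (hn : 1 ≤ n) (K : Set (Euc n)) (hK : IsConvexBody K)
    (p : ℝ) (hp0 : 0 < p) (hp1 : p < 1) :
    fourierMeanBody p K =
        (Real.Gamma (1 + p) * Real.cos (Real.pi * p / 2) * volume.real K) ^ (1 / p) •
          polarMeanZonoid (-p) K ∧
      IsConvexBody (fourierMeanBody p K) ∧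
      -fourierMeanBody p K = fourierMeanBody p K := by
  have hΓ : 0 < Real.Gamma (1 + p) := Real.Gamma_pos_of_pos (by linarith)
  have hcos : 0 < Real.cos (Real.pi * p / 2) := Real.cos_pos_of_mem_Ioo
    ⟨by nlinarith [Real.pi_pos], by nlinarith [Real.pi_pos]⟩
  have hpn : p < n := hp1.trans_le (by exact_mod_cast hn)
  have ha := mul_pos hΓ hcos
  have hC0 : ENNReal.ofReal (Real.Gamma (1 + p) * Real.cos (Real.pi * p / 2)) / volume K ≠ 0 :=
    ENNReal.div_ne_zero.2 ⟨by simpa using ha, hK.volume_ne_top⟩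
  have hC : ENNReal.ofReal (Real.Gamma (1 + p) * Real.cos (Real.pi * p / 2)) / volume K ≠ ∞ :=
    ENNReal.div_ne_top ENNReal.ofReal_ne_top hK.volume_ne_zero
  rw [fourierMeanBody_eq hK hp0 hp1]
  exact ⟨(smul_polarMeanZonoid hn hK hp0 hpn ha).symm,
    isConvexBody_starSet_negMoment (isLogConcaveBump_covariogram hK) hp0 hp1 hC0 hC⟩
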